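/- Work in Peano arithmetic $\mathsf{PA}$ in the first-order language $\{0,S,+,\cdot,<\}$. A $\Delta_0$ formula is one in which all quantifiers are bounded; a $\Sigma_1$ (resp. $\Pi_1$) formula is a block of existential (resp. universal) quantifiers followed by a $\Delta_0$ formula; a sentence is true if it holds in the standard model $\mathbb N$. Binary strings are identified with natural numbers (the string $s$ with the number whose successor has binary expansion $1s$, up to the order of the digits of $s$), and $|p|$ is the length of the string $p$. An interpreter is a $\Sigma_1$ formula $D(p,y)$ (read: program $p$ outputs $y$) such that $\mathsf{PA}\vdash\forall p\,\forall y\,\forall y'\,[D(p,y)\wedge D(p,y')\to y=y']$, and $\mathrm C_D(y)$ denotes the minimal length $|p|$ of a $p$ with $D(p,y)$ ($\infty$ if there is none). An interpreter $D$ is provably optimal if for every interpreter $D'$ there is a constant $c\in\mathbb N$ such that $\mathsf{PA}\vdash\forall y\,[\mathrm C_D(y)\le \mathrm C_{D'}(y)+c]$. Theorem. Let $D$ be any provably optimal interpreter, and let $\mathrm C=\mathrm C_D$ be the plain Kolmogorov complexity defined by $D$ (and formalized in $\mathsf{PA}$ through the formula $D$). If one adds to $\mathsf{PA}$ as axioms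 all true sentences of the form ``$\mathrm C(x)>n$'', where $x$ is a binary string and $n\in\mathbb N$, then the resulting theory proves every true $\Pi_1$ sentence. -/

import Mathlib

open FirstOrder FirstOrder.Language

/-! ### First-order proofs

Formulas are Mathlib's `BoundedFormula L α n`: the free variables are indexed by `α` and by `Fin n`,
and `all` binds the variable `Fin.last n`. The primitive connectives are `⊥`, `→` and `∀`. -/

namespace FOProof

universe u v
variable {L : FirstOrder.Language.{u, v}} {α β : Type}

/-- View a term with variables among `α ⊕ Fin n` as one with variables among `α ⊕ Fin (n + 1)`. -/
def up {n : ℕ} (t : L.Term (α ⊕ Fin n)) : L.Term (α ⊕ Fin (n + 1)) :=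
  t.relabel (Sum.map id Fin.castSucc)

/-- Extend a substitution under one quantifier: the newly bound variable stays fixed. -/
def liftSub {n m : ℕ} (σ : α ⊕ Fin n → L.Term (β ⊕ Fin m)) :
    α ⊕ Fin (n + 1) → L.Term (β ⊕ Fin (m + 1)) :=
  Sum.elim (fun a => up (σ (Sum.inl a)))
    (Fin.snoc (α := fun _ => L.Term (β ⊕ Fin (m + 1))) (fun i => up (σ (Sum.inr i)))
      (Term.var (Sum.inr (Fin.last m))))

/-- Simultaneous capture-avoiding substitution of terms for all free variables of a formula. -/
def sub : ∀ {n m : ℕ}, L.BoundedFormula α n → (α ⊕ Fin n → L.Term (β ⊕ Fin m)) →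
    L.BoundedFormula β m
  | _, _, .falsum, _ => .falsum
  | _, _, .equal t u, σ => .equal (t.subst σ) (u.subst σ)
  | _, _, .rel R ts, σ => .rel R (fun i => (ts i).subst σ)
  | _, _, .imp φ ψ, σ => .imp (sub φ σ) (sub ψ σ)
  | _, _, .all φ, σ => .all (sub φ (liftSub σ))

/-- A sentence, as a formula with free variables among `x₀, x₁, …` (none of which occurs in it). -/
def ofSentence (φ : L.Sentence) : L.Formula ℕ :=
  sub φ (Sum.elim (fun e => e.elim) (fun i => i.elim0))

/-- Rename each free variable `xᵢ` to `xᵢ₊₁`, so that `x₀` becomes fresh. -/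
def shift (φ : L.Formula ℕ) : L.Formula ℕ :=
  sub φ (Sum.elim (fun i => Term.var (Sum.inl (i + 1))) (fun i => i.elim0))

/-- `φ(t)`, for a formula `φ` with one distinguished variable. -/
def inst (φ : L.BoundedFormula ℕ 1) (t : L.Term (ℕ ⊕ Fin 0)) : L.Formula ℕ :=
  sub φ (Sum.elim (fun i => Term.var (Sum.inl i)) (fun _ => t))

/-- `φ(x₀)`, where every other free variable `xᵢ` of `φ` has been renamed to `xᵢ₊₁`,
so that `x₀` is fresh. -/
def instFresh (φ : L.BoundedFormula ℕ 1) : L.Formula ℕ :=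
  sub φ (Sum.elim (fun i => Term.var (Sum.inl (i + 1))) (fun _ => Term.var (Sum.inl 0)))

/-- Natural deduction for classical first-order logic with equality:
`Derivable Γ φ` means that there is a (finite) derivation of `φ` from hypotheses in `Γ`. -/
inductive Derivable : Set (L.Formula ℕ) → L.Formula ℕ → Prop
  | hyp {Γ : Set (L.Formula ℕ)} {φ : L.Formula ℕ} : φ ∈ Γ → Derivable Γ φ
  | impIntro {Γ : Set (L.Formula ℕ)} {φ ψ : L.Formula ℕ} :
      Derivable (insert φ Γ) ψ → Derivable Γ (φ.imp ψ)
  | impElim {Γ : Set (L.Formula ℕ)} {φ ψ : L.Formula ℕ} :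
      Derivable Γ (φ.imp ψ) → Derivable Γ φ → Derivable Γ ψ
  | byContra {Γ : Set (L.Formula ℕ)} {φ : L.Formula ℕ} :
      Derivable (insert (BoundedFormula.imp φ .falsum) Γ) .falsum → Derivable Γ φ
  | allIntro {Γ : Set (L.Formula ℕ)} {φ : L.BoundedFormula ℕ 1} :
      Derivable (shift '' Γ) (instFresh φ) → Derivable Γ (BoundedFormula.all φ)
  | allElim {Γ : Set (L.Formula ℕ)} {φ : L.BoundedFormula ℕ 1} (t : L.Term (ℕ ⊕ Fin 0)) :
      Derivable Γ (BoundedFormula.all φ) → Derivable Γ (inst φ t)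
  | eqRefl {Γ : Set (L.Formula ℕ)} (t : L.Term (ℕ ⊕ Fin 0)) :
      Derivable Γ (BoundedFormula.equal t t)
  | eqSubst {Γ : Set (L.Formula ℕ)} {φ : L.BoundedFormula ℕ 1} {t u : L.Term (ℕ ⊕ Fin 0)} :
      Derivable Γ (BoundedFormula.equal t u) → Derivable Γ (inst φ t) → Derivable Γ (inst φ u)

/-- `T ⊢ φ`: the theory `T` proves the sentence `φ`. -/
def Proves (T : L.Theory) (φ : L.Sentence) : Prop :=
  Derivable (ofSentence '' T) (ofSentence φ)

end FOProof

/-! ### Peano arithmetic -/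

namespace Arith

open FOProof

/-- The function symbols `0`, `S`, `+`, `·`. -/
inductive Func : ℕ → Type
  | zero : Func 0
  | succ : Func 1
  | add : Func 2
  | mul : Func 2

/-- The relation symbol `<`. -/
inductive Rel : ℕ → Type
  | lt : Rel 2

/-- The language of arithmetic. -/
def LA : FirstOrder.Language.{0, 0} := ⟨Func, Rel⟩

/-- The standard model. -/
instance standardModel : LA.Structure ℕ where
  funMap := fun {_} f v =>
    match f with
    | .zero => 0
    | .succ => v 0 + 1
    | .add => v 0 + v 1
    | .mul => v 0 * v 1
  RelMap := fun {_} r v =>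
    match r with
    | .lt => v 0 < v 1

section Symbols
variable {γ : Type}

def zero : LA.Term γ := Term.func Func.zero ![]
def succ (t : LA.Term γ) : LA.Term γ := Term.func Func.succ ![t]
def add (t u : LA.Term γ) : LA.Term γ := Term.func Func.add ![t, u]
def mul (t u : LA.Term γ) : LA.Term γ := Term.func Func.mul ![t, u]

/-- The numeral `S(S(…S(0)…))`. -/
def num : ℕ → LA.Term γ
  | 0 => zero
  | k + 1 => succ (num k)

end Symbols

/-- The `i`-th variable (numbered from the outermost quantifier inwards). -/
def x {n : ℕ} (i : Fin n) : LA.Term (Empty ⊕ Fin n) := Term.var (Sum.inr i)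

def eq {n : ℕ} (t u : LA.Term (Empty ⊕ Fin n)) : LA.BoundedFormula Empty n :=
  BoundedFormula.equal t u

def lt {n : ℕ} (t u : LA.Term (Empty ⊕ Fin n)) : LA.BoundedFormula Empty n :=
  BoundedFormula.rel Rel.lt ![t, u]

/-- `φ(t₀, …, tₖ₋₁)`. -/
def app {k n : ℕ} (φ : LA.BoundedFormula Empty k) (t : Fin k → LA.Term (Empty ⊕ Fin n)) :
    LA.BoundedFormula Empty n :=
  sub φ (Sum.elim (fun e => e.elim) t)

/-- The induction axiom for `φ(y₀, …, yₙ₋₁, z)`, with parameters `y₀, …, yₙ₋₁`: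
`∀ y₀ … yₙ₋₁, φ(y, 0) → (∀ z, φ(y, z) → φ(y, S z)) → ∀ z, φ(y, z)`. -/
def induction {n : ℕ} (φ : LA.BoundedFormula Empty (n + 1)) : LA.Sentence :=
  BoundedFormula.alls
    ((app φ (Fin.snoc (α := fun _ => LA.Term (Empty ⊕ Fin n)) x zero)).imp
      ((φ.imp (app φ (Fin.snoc (α := fun _ => LA.Term (Empty ⊕ Fin (n + 1)))
          (fun i => x i.castSucc) (succ (x (Fin.last n)))))).all.imp
        φ.all))

/-- The axioms of Peano arithmetic. -/
inductive PAAxiom : LA.Sentence → Prop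
  | succ_ne_zero : PAAxiom (eq (succ (x (0 : Fin 1))) zero).not.all
  | succ_inj : PAAxiom
      ((eq (succ (x (0 : Fin 2))) (succ (x 1))).imp (eq (x 0) (x 1))).all.all
  | add_zero : PAAxiom (eq (add (x (0 : Fin 1)) zero) (x 0)).all
  | add_succ : PAAxiom
      (eq (add (x (0 : Fin 2)) (succ (x 1))) (succ (add (x 0) (x 1)))).all.all
  | mul_zero : PAAxiom (eq (mul (x (0 : Fin 1)) zero) zero).all
  | mul_succ : PAAxiom
      (eq (mul (x (0 : Fin 2)) (succ (x 1))) (add (mul (x 0) (x 1)) (x 0))).all.all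
  | not_lt_zero : PAAxiom (lt (x (0 : Fin 1)) zero).not.all
  | lt_succ : PAAxiom
      ((lt (x (0 : Fin 2)) (succ (x 1))).iff (lt (x 0) (x 1) ⊔ eq (x 0) (x 1))).all.all
  | ind {n : ℕ} (φ : LA.BoundedFormula Empty (n + 1)) : PAAxiom (induction φ)

/-- Peano arithmetic. -/
def PA : LA.Theory := {φ | PAAxiom φ}

/-- `Δ₀` formulas: all quantifiers are bounded, `∀ z < t` or `∃ z < t` with `z` not in `t`. -/
inductive IsDelta0 : ∀ {n : ℕ}, LA.BoundedFormula Empty n → Prop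
  | falsum {n : ℕ} : IsDelta0 (BoundedFormula.falsum : LA.BoundedFormula Empty n)
  | eq {n : ℕ} (t u : LA.Term (Empty ⊕ Fin n)) : IsDelta0 (eq t u)
  | lt {n : ℕ} (t u : LA.Term (Empty ⊕ Fin n)) : IsDelta0 (lt t u)
  | imp {n : ℕ} {φ ψ : LA.BoundedFormula Empty n} :
      IsDelta0 φ → IsDelta0 ψ → IsDelta0 (φ.imp ψ)
  | ball {n : ℕ} (t : LA.Term (Empty ⊕ Fin n)) {φ : LA.BoundedFormula Empty (n + 1)} :
      IsDelta0 φ → IsDelta0 ((Arith.lt (x (Fin.last n)) (up t)).imp φ).all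
  | bex {n : ℕ} (t : LA.Term (Empty ⊕ Fin n)) {φ : LA.BoundedFormula Empty (n + 1)} :
      IsDelta0 φ → IsDelta0 (Arith.lt (x (Fin.last n)) (up t) ⊓ φ).ex

/-- `Σ₁` formulas: `∃ z₁ … zₖ, θ` with `θ` in `Δ₀`. -/
inductive IsSigma1 : ∀ {n : ℕ}, LA.BoundedFormula Empty n → Prop
  | delta0 {n : ℕ} {φ : LA.BoundedFormula Empty n} : IsDelta0 φ → IsSigma1 φ
  | ex {n : ℕ} {φ : LA.BoundedFormula Empty (n + 1)} : IsSigma1 φ → IsSigma1 φ.ex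

/-- `Π₁` formulas: `∀ z₁ … zₖ, θ` with `θ` in `Δ₀`. -/
inductive IsPi1 : ∀ {n : ℕ}, LA.BoundedFormula Empty n → Prop
  | delta0 {n : ℕ} {φ : LA.BoundedFormula Empty n} : IsDelta0 φ → IsPi1 φ
  | all {n : ℕ} {φ : LA.BoundedFormula Empty (n + 1)} : IsPi1 φ → IsPi1 φ.all

/-! ### Kolmogorov complexity in arithmetic -/

/-- The usual bijection between binary strings and natural numbers: the binary expansion of
`code s + 1` is `s` (least significant digit first) followed by a leading `1`. -/
def code : List Bool → ℕ
  | [] => 0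
  | b :: s => 2 * code s + (if b then 2 else 1)

/-- The string coded by `p` has length at most `n` if and only if `p + 1 < 2 ^ (n + 1)`. -/
theorem code_add_one_lt_iff (s : List Bool) (n : ℕ) :
    code s + 1 < 2 ^ (n + 1) ↔ s.length ≤ n := by
  induction s generalizing n with
  | nil => simp [code]
  | cons b s ih =>
    cases n with
    | zero => cases b <;> simp [code]
    | succ n =>
      have h := ih n
      rw [List.length_cons, Nat.succ_le_succ_iff, ← h, pow_succ 2 (n + 1)]
      cases b <;> simp [code] <;> omega

/-- An interpreter of a programming language (a partial computable function from programs to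
outputs, both being strings coded by numbers), as it appears in arithmetic: a `Σ₁` formula
`D(p, y)`, saying that `y` is the output of `p`, such that `PA` proves that every program
has at most one output. -/
def IsInterpreter (D : LA.BoundedFormula Empty 2) : Prop :=
  IsSigma1 D ∧
  Proves PA
    ((app D ![x (0 : Fin 3), x 1]).imp
      ((app D ![x (0 : Fin 3), x 2]).imp (eq (x 1) (x 2)))).all.all.all

/-- `t` is a power of two: every divisor of `t` is `1` or even. -/
def isPowTwo {n : ℕ} (t : LA.Term (Empty ⊕ Fin n)) : LA.BoundedFormula Empty n :=
  ((eq (mul (x (Fin.last n).castSucc) (x (Fin.last (n + 1)))) (up (up t))).imp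
    (eq (x (Fin.last n).castSucc) (num 1) ⊔
      (eq (x (Fin.last n).castSucc.castSucc)
        (add (x (Fin.last (n + 2))) (x (Fin.last (n + 2))))).ex)).all.all

/-- The strings coded by `t` and `u` satisfy `|t| ≤ |u| + c`: there is a power of two `w` such that
`w ≤ u + 1` and `t + 1 < 2 ^ (c + 1) * w` (the largest such `w` being `2 ^ |u|`). -/
def lenLe {n : ℕ} (t u : LA.Term (Empty ⊕ Fin n)) (c : ℕ) : LA.BoundedFormula Empty n :=
  (isPowTwo (x (Fin.last n)) ⊓
    (lt (x (Fin.last n)) (succ (succ (up u))) ⊓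
      lt (succ (up t)) (mul (num (2 ^ (c + 1))) (x (Fin.last n))))).ex

/-- The sentence `∀ y, C_D(y) ≤ C_E(y) + c`: for all `y` and `q` with `E(q) = y` there is `p`
with `|p| ≤ |q| + c` and `D(p) = y`. -/
def complexityLe (D E : LA.BoundedFormula Empty 2) (c : ℕ) : LA.Sentence :=
  ((app E ![x (1 : Fin 2), x 0]).imp
    (lenLe (x (2 : Fin 3)) (x 1) c ⊓ app D ![x (2 : Fin 3), x 0]).ex).all.all

/-- `D` is a provably optimal interpreter. -/
def ProvablyOptimal (D : LA.BoundedFormula Empty 2) : Prop :=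
  IsInterpreter D ∧
    ∀ E : LA.BoundedFormula Empty 2, IsInterpreter E → ∃ c : ℕ, Proves PA (complexityLe D E c)

/-- The sentence `C_D(s) > n`: no program `p` of length at most `n` has output `s`. -/
def complexityGt (D : LA.BoundedFormula Empty 2) (s : List Bool) (n : ℕ) : LA.Sentence :=
  ((lt (succ (x (0 : Fin 1))) (num (2 ^ (n + 1)))).imp
    (app D ![x (0 : Fin 1), num (code s)]).not).all

/-- All true sentences of the form `C_D(s) > n`. -/
def trueComplexityAxioms (D : LA.BoundedFormula Empty 2) : LA.Theory :=
  {φ | (∃ (s : List Bool) (n : ℕ), φ = complexityGt D s n) ∧ Sentence.Realize ℕ φ}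

end Arith

namespace FOProof

universe u v
variable {L : FirstOrder.Language.{u, v}} {α β γ : Type}

/-! ### Substitution -/

/-! By soundness and completeness this is a statement about models: a model `M` of PA that satisfies
every true bound C(x) > n contains no counterexample to a true Π₁ sentence. Write the negation of
the sentence as ∃ b, F(b) and D(p, y) as ∃ b, G(p, y, b), where F and G are Δ₀ and G is monotone in
b ("p outputs y within b steps"); this is `IsSigma1.exists_bound`. If `M` has a counterexample, its
least b with F(b) is nonstandard, since Δ₀ formulas are absolute (`IsDelta0.realize_numM`) and F
fails throughout ℕ. So b exceeds the running time of every computation that halts in ℕ.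

The interpreter E = `searchInterpreter F G` exploits this: on input p it waits for b, then outputs
the least y that no program q < (p+1)² produces within b steps. It never halts in ℕ, but PA proves
that it is functional, so optimality gives c with C_D ≤ C_E + c in `M`. Take p + 1 = 2^(c+1), so |p|
= c+1 and the search covers q < 2^(2c+2); let y be the output in `M`. This y is standard, because
some standard y₀ truly satisfies C(y₀) > 2c+2, and that axiom makes y₀ a candidate in `M`. Moreover
C(y) > 2c+1 is true in ℕ, since a shorter program producing y in ℕ would do so before time b. Hence
it is an axiom and holds in `M`, whereas optimality gives a program for y in `M` of length at most
(c+1) + c. The contradiction is `false_of_counterexample`; the logical bridge is `Proves.sound` and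
`proves_of_forall_model`. -/

theorem subst_subst (t : L.Term α) (σ : α → L.Term β) (τ : β → L.Term γ) :
    (t.subst σ).subst τ = t.subst (fun a => (σ a).subst τ) := by
  induction t with
  | var => rfl
  | func f ts ih => simp [Term.subst, ih]

theorem subst_var (t : L.Term α) : t.subst Term.var = t := by
  induction t with
  | var => rfl
  | func f ts ih => simp [Term.subst, ih]

theorem relabel_subst (t : L.Term α) (g : α → β) (σ : β → L.Term γ) :
    (t.relabel g).subst σ = t.subst (fun a => σ (g a)) := by
  induction t with
  | var => rfl
  | func f ts ih => simpa [Term.subst, Term.relabel] using funext fun i => ih i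

theorem up_subst {n m : ℕ} (t : L.Term (α ⊕ Fin n)) (σ : α ⊕ Fin (n + 1) → L.Term (β ⊕ Fin m)) :
    (up t).subst σ = t.subst (fun a => σ (Sum.map id Fin.castSucc a)) :=
  relabel_subst _ _ _

theorem up_subst_liftSub {n m : ℕ} (t : L.Term (α ⊕ Fin n))
    (σ : α ⊕ Fin n → L.Term (β ⊕ Fin m)) :
    (up t).subst (liftSub σ) = up (t.subst σ) := by
  induction t with
  | var a => cases a <;> simp [up, Term.subst, Term.relabel, liftSub]
  | func f ts ih => simpa [up, Term.subst, Term.relabel] using funext fun i => ih i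

theorem liftSub_subst_liftSub {n m k : ℕ} (σ : α ⊕ Fin n → L.Term (β ⊕ Fin m))
    (τ : β ⊕ Fin m → L.Term (γ ⊕ Fin k)) :
    (fun a => (liftSub σ a).subst (liftSub τ)) = liftSub (fun a => (σ a).subst τ) := by
  funext a
  rcases a with a | i
  · exact up_subst_liftSub _ _
  · induction i using Fin.lastCases with
    | last => simp [liftSub, Term.subst]
    | cast i =>
      simpa [liftSub] using up_subst_liftSub (σ (Sum.inr i)) τ

theorem sub_sub {n m k : ℕ} (φ : L.BoundedFormula α n) (σ : α ⊕ Fin n → L.Term (β ⊕ Fin m))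
    (τ : β ⊕ Fin m → L.Term (γ ⊕ Fin k)) :
    sub (sub φ σ) τ = sub φ (fun a => (σ a).subst τ) := by
  induction φ generalizing m k with
  | falsum => rfl
  | equal t u => simp [sub, subst_subst]
  | rel R ts => simp [sub, subst_subst]
  | imp φ ψ h₁ h₂ => simp [sub, h₁, h₂]
  | all φ ih => simp only [sub, ih, liftSub_subst_liftSub]

theorem liftSub_var {n : ℕ} :
    liftSub (Term.var : α ⊕ Fin n → L.Term (α ⊕ Fin n)) = Term.var := by
  funext a
  rcases a with a | i
  · rfl
  · induction i using Fin.lastCases <;> simp [liftSub, up, Term.relabel]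

theorem sub_var {n : ℕ} (φ : L.BoundedFormula α n) : sub φ Term.var = φ := by
  induction φ with
  | falsum => rfl
  | equal t u => simp [sub, subst_var]
  | rel R ts => simp [sub, subst_var]
  | imp φ ψ h₁ h₂ => simp [sub, h₁, h₂]
  | all φ ih => simp only [sub, liftSub_var, ih]

/-! ### Semantics of substitution and soundness. -/

section Semantics
variable {M : Type*} [L.Structure M]

theorem realize_up {n : ℕ} (t : L.Term (α ⊕ Fin n)) (v : α → M) (xs : Fin n → M) (a : M) :
    (up t).realize (Sum.elim v (Fin.snoc xs a)) = t.realize (Sum.elim v xs) := by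
  rw [up, Term.realize_relabel]
  congr 1
  funext b
  rcases b with b | i <;> simp

theorem realize_sub {n m : ℕ} (φ : L.BoundedFormula α n) (σ : α ⊕ Fin n → L.Term (β ⊕ Fin m))
    (v : β → M) (xs : Fin m → M) :
    (sub φ σ).Realize v xs ↔
      φ.Realize (fun a => (σ (Sum.inl a)).realize (Sum.elim v xs))
        (fun i => (σ (Sum.inr i)).realize (Sum.elim v xs)) := by
  have key : ∀ {n m : ℕ} (t : L.Term (α ⊕ Fin n)) (σ : α ⊕ Fin n → L.Term (β ⊕ Fin m))
      (xs : Fin m → M), (t.subst σ).realize (Sum.elim v xs) =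
      t.realize (Sum.elim (fun a => (σ (Sum.inl a)).realize (Sum.elim v xs))
        (fun i => (σ (Sum.inr i)).realize (Sum.elim v xs))) := by
    intro n m t σ xs
    rw [Term.realize_subst]
    congr 1
    funext a
    rcases a with a | i <;> rfl
  induction φ generalizing m with
  | falsum => rfl
  | equal t u => simp only [sub, BoundedFormula.Realize, key]
  | rel R ts => simp only [sub, BoundedFormula.Realize, key]
  | imp φ ψ h₁ h₂ => simp only [sub, BoundedFormula.Realize, h₁, h₂]
  | all φ ih =>
    simp only [sub, BoundedFormula.Realize, ih]
    refine forall_congr' fun a => ?_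
    have h₁ : (fun b => (liftSub σ (Sum.inl b)).realize (Sum.elim v (Fin.snoc xs a))) =
        fun b => (σ (Sum.inl b)).realize (Sum.elim v xs) := by
      funext b
      exact realize_up _ _ _ _
    have h₂ : (fun i => (liftSub σ (Sum.inr i)).realize (Sum.elim v (Fin.snoc xs a))) =
        (Fin.snoc (fun i => (σ (Sum.inr i)).realize (Sum.elim v xs)) a : Fin _ → M) := by
      funext i
      induction i using Fin.lastCases with
      | last => simp [liftSub]
      | cast i => simpa [liftSub] using realize_up _ _ _ _
    rw [h₁, h₂]

theorem realize_ofSentence (φ : L.Sentence) (v : ℕ → M) (xs : Fin 0 → M) :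
    BoundedFormula.Realize (ofSentence φ) v xs ↔ Sentence.Realize M φ := by
  rw [ofSentence, realize_sub]
  exact iff_of_eq (congrArg₂ _ (Subsingleton.elim _ _) (Subsingleton.elim _ _))

theorem realize_shift (φ : L.Formula ℕ) (v : ℕ → M) (xs : Fin 0 → M) :
    BoundedFormula.Realize (shift φ) v xs ↔ BoundedFormula.Realize φ (fun i => v (i + 1)) xs := by
  rw [shift, realize_sub]
  exact iff_of_eq (congrArg₂ _ rfl (Subsingleton.elim _ _))

theorem realize_inst (φ : L.BoundedFormula ℕ 1) (t : L.Term (ℕ ⊕ Fin 0)) (v : ℕ → M)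
    (xs : Fin 0 → M) :
    BoundedFormula.Realize (inst φ t) v xs ↔ φ.Realize v (fun _ => t.realize (Sum.elim v xs)) := by
  rw [inst, realize_sub]
  rfl

theorem realize_instFresh (φ : L.BoundedFormula ℕ 1) (v : ℕ → M) (xs : Fin 0 → M) :
    BoundedFormula.Realize (instFresh φ) v xs ↔ φ.Realize (fun i => v (i + 1)) (fun _ => v 0) := by
  rw [instFresh, realize_sub]
  rfl

theorem snoc_zero (xs : Fin 0 → M) (a : M) :
    (Fin.snoc xs a : Fin (0 + 1) → M) = fun _ => a := by
  funext i
  simp [Fin.snoc]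

theorem Derivable.sound {Γ : Set (L.Formula ℕ)} {φ : L.Formula ℕ} (h : Derivable Γ φ)
    (v : ℕ → M) (hΓ : ∀ ψ ∈ Γ, BoundedFormula.Realize ψ v default) :
    BoundedFormula.Realize φ v default := by
  induction h generalizing v with
  | hyp h => exact hΓ _ h
  | impIntro _ ih =>
    intro hφ
    refine ih v fun ψ hψ => ?_
    rcases hψ with rfl | hψ
    exacts [hφ, hΓ ψ hψ]
  | impElim _ _ ih₁ ih₂ => exact ih₁ v hΓ (ih₂ v hΓ)
  | byContra _ ih =>
    by_contra hφ
    refine ih v fun ψ hψ => ?_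
    rcases hψ with rfl | hψ
    exacts [hφ, hΓ ψ hψ]
  | @allIntro Γ φ _ ih =>
    intro a
    -- The eigenvariable `x₀` takes the arbitrary value `a`; moving `v` up by one compensates for
    -- `shift` on the hypotheses.
    have := ih (fun i => Nat.casesOn i a v) (by
      rintro _ ⟨ψ, hψ, rfl⟩
      exact (realize_shift _ _ _).2 (hΓ ψ hψ))
    rw [realize_instFresh] at this
    rwa [snoc_zero]
  | allElim t _ ih =>
    rw [realize_inst]
    have := ih v hΓ (t.realize (Sum.elim v default))
    rwa [snoc_zero] at this
  | eqRefl t => rfl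
  | eqSubst _ _ ih₁ ih₂ =>
    have h₁ := ih₁ v hΓ
    have h₂ := ih₂ v hΓ
    rw [realize_inst] at h₂ ⊢
    simp only [BoundedFormula.Realize] at h₁
    rwa [← h₁]

theorem Proves.sound {T : L.Theory} {φ : L.Sentence} (h : Proves T φ) [Nonempty M]
    (hM : ∀ ψ ∈ T, Sentence.Realize M ψ) : Sentence.Realize M φ := by
  obtain ⟨a⟩ := ‹Nonempty M›
  refine (realize_ofSentence φ (fun _ => a) default).1 (Derivable.sound h _ ?_)
  rintro _ ⟨ψ, hψ, rfl⟩
  exact (realize_ofSentence ψ _ _).2 (hM ψ hψ)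

end Semantics

/-! ### Structural properties of derivations -/

theorem Derivable.mono {Γ Δ : Set (L.Formula ℕ)} {φ : L.Formula ℕ} (h : Derivable Γ φ)
    (hΓ : Γ ⊆ Δ) : Derivable Δ φ := by
  induction h generalizing Δ with
  | hyp h => exact .hyp (hΓ h)
  | impIntro _ ih => exact .impIntro (ih (Set.insert_subset_insert hΓ))
  | impElim _ _ ih₁ ih₂ => exact .impElim (ih₁ hΓ) (ih₂ hΓ)
  | byContra _ ih => exact .byContra (ih (Set.insert_subset_insert hΓ))
  | allIntro _ ih => exact .allIntro (ih (Set.image_mono hΓ))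
  | allElim t _ ih => exact .allElim t (ih hΓ)
  | eqRefl t => exact .eqRefl t
  | eqSubst _ _ ih₁ ih₂ => exact .eqSubst (ih₁ hΓ) (ih₂ hΓ)

theorem exists_finite_subset_of_insert {δ : Type*} {a : δ} {s t : Set δ} (ht : t.Finite)
    (hts : t ⊆ insert a s) : ∃ t' ⊆ s, t'.Finite ∧ t ⊆ insert a t' :=
  ⟨t \ {a}, fun _ hb => (hts hb.1).resolve_left hb.2, ht.sdiff, by
    intro b hb
    by_cases h : b = a
    · exact Or.inl h
    · exact Or.inr ⟨hb, h⟩⟩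

/-- Derivations are finite. This is what keeps unions of chains of consistent sets consistent. -/
theorem Derivable.compact {Γ : Set (L.Formula ℕ)} {φ : L.Formula ℕ} (h : Derivable Γ φ) :
    ∃ Γ₀ ⊆ Γ, Γ₀.Finite ∧ Derivable Γ₀ φ := by
  induction h with
  | @hyp Γ φ h => exact ⟨{φ}, by simpa using h, Set.finite_singleton _, .hyp rfl⟩
  | impIntro _ ih =>
    obtain ⟨t, h₁, h₂, h₃⟩ := ih
    obtain ⟨t', h₄, h₅, h₆⟩ := exists_finite_subset_of_insert h₂ h₁
    exact ⟨t', h₄, h₅, .impIntro (h₃.mono h₆)⟩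
  | impElim _ _ ih₁ ih₂ =>
    obtain ⟨t, h₁, h₂, h₃⟩ := ih₁
    obtain ⟨u, h₄, h₅, h₆⟩ := ih₂
    exact ⟨t ∪ u, Set.union_subset h₁ h₄, h₂.union h₅,
      .impElim (h₃.mono Set.subset_union_left) (h₆.mono Set.subset_union_right)⟩
  | byContra _ ih =>
    obtain ⟨t, h₁, h₂, h₃⟩ := ih
    obtain ⟨t', h₄, h₅, h₆⟩ := exists_finite_subset_of_insert h₂ h₁
    exact ⟨t', h₄, h₅, .byContra (h₃.mono h₆)⟩
  | allIntro _ ih =>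
    obtain ⟨t, h₁, h₂, h₃⟩ := ih
    obtain ⟨t', h₄, h₅, h₆⟩ :=
      (Set.exists_subset_image_finite_and (p := fun t => Derivable t _)).1 ⟨t, h₁, h₂, h₃⟩
    exact ⟨t', h₄, h₅, .allIntro h₆⟩
  | allElim t _ ih =>
    obtain ⟨t', h₁, h₂, h₃⟩ := ih
    exact ⟨t', h₁, h₂, .allElim t h₃⟩
  | eqRefl t => exact ⟨∅, Set.empty_subset _, Set.finite_empty, .eqRefl t⟩
  | eqSubst _ _ ih₁ ih₂ =>
    obtain ⟨t, h₁, h₂, h₃⟩ := ih₁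
    obtain ⟨u, h₄, h₅, h₆⟩ := ih₂
    exact ⟨t ∪ u, Set.union_subset h₁ h₄, h₂.union h₅,
      .eqSubst (h₃.mono Set.subset_union_left) (h₆.mono Set.subset_union_right)⟩

/-- Substitution of terms for the free variables. -/
def fsub (φ : L.Formula ℕ) (σ : ℕ → L.Term (ℕ ⊕ Fin 0)) : L.Formula ℕ :=
  sub φ (Sum.elim σ (fun i => i.elim0))

/-- `σ` shifted past the fresh variable `x₀`. -/
def shiftSub (σ : ℕ → L.Term (ℕ ⊕ Fin 0)) : ℕ → L.Term (ℕ ⊕ Fin 0)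
  | 0 => Term.var (Sum.inl 0)
  | i + 1 => (σ i).subst (Sum.elim (fun i => Term.var (Sum.inl (i + 1))) (fun i => i.elim0))

/-- Substitution of terms for the free variables, under one quantifier. -/
def fsub₁ (φ : L.BoundedFormula ℕ 1) (σ : ℕ → L.Term (ℕ ⊕ Fin 0)) : L.BoundedFormula ℕ 1 :=
  sub φ (liftSub (Sum.elim σ (fun i => i.elim0)))

theorem liftSub_zero_inr {m : ℕ} (σ : α ⊕ Fin 0 → L.Term (β ⊕ Fin m)) (i : Fin 1) :
    liftSub σ (Sum.inr i) = Term.var (Sum.inr (Fin.last m)) := by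
  rw [Subsingleton.elim i (Fin.last 0)]
  simp only [liftSub, Sum.elim_inr, Fin.snoc_last]

theorem up_subst_elim {β : Type} {m : ℕ} (t : L.Term (α ⊕ Fin 0))
    (f : α → L.Term (β ⊕ Fin m)) (g : Fin 1 → L.Term (β ⊕ Fin m)) (g' : Fin 0 → _) :
    (up t).subst (Sum.elim f g) = t.subst (Sum.elim f g') := by
  rw [up_subst]
  congr 1
  funext a
  rcases a with a | a
  · rfl
  · exact a.elim0

theorem inst_fsub₁ (φ : L.BoundedFormula ℕ 1) (t : L.Term (ℕ ⊕ Fin 0))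
    (σ : ℕ → L.Term (ℕ ⊕ Fin 0)) :
    fsub (inst φ t) σ = inst (fsub₁ φ σ) (t.subst (Sum.elim σ (fun i => i.elim0))) := by
  simp only [fsub, inst, fsub₁, sub_sub]
  congr 1
  funext a
  rcases a with a | a
  · simp only [Sum.elim_inl, Term.subst, liftSub]
    rw [up_subst_elim _ _ _ (fun i => i.elim0)]
    conv_lhs => rw [← subst_var (σ a)]
    congr 1
    funext b
    rcases b with b | b
    · rfl
    · exact b.elim0
  · simp [liftSub_zero_inr, Term.subst]

theorem instFresh_fsub₁ (φ : L.BoundedFormula ℕ 1) (σ : ℕ → L.Term (ℕ ⊕ Fin 0)) :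
    fsub (instFresh φ) (shiftSub σ) = instFresh (fsub₁ φ σ) := by
  simp only [fsub, instFresh, fsub₁, sub_sub]
  congr 1
  funext a
  rcases a with a | a
  · simp only [Sum.elim_inl, Term.subst, liftSub]
    rw [up_subst_elim _ _ _ (fun i => i.elim0)]
    rfl
  · simp [liftSub_zero_inr, Term.subst, shiftSub]

theorem shift_fsub (φ : L.Formula ℕ) (σ : ℕ → L.Term (ℕ ⊕ Fin 0)) :
    fsub (shift φ) (shiftSub σ) = shift (fsub φ σ) := by
  simp only [fsub, shift, sub_sub]
  congr 1
  funext a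
  rcases a with a | a
  · rfl
  · exact a.elim0

/-- Needed for renaming eigenvariables in `Derivable.all_of_fresh`. The induction varies `σ`,
because `allIntro` passes from `σ` to `shiftSub σ`. -/
theorem Derivable.fsub {Γ : Set (L.Formula ℕ)} {φ : L.Formula ℕ} (h : Derivable Γ φ)
    (σ : ℕ → L.Term (ℕ ⊕ Fin 0)) :
    Derivable ((fun ψ => FOProof.fsub ψ σ) '' Γ) (FOProof.fsub φ σ) := by
  induction h generalizing σ with
  | hyp h => exact .hyp ⟨_, h, rfl⟩
  | impIntro _ ih =>
    have := ih σ
    rw [Set.image_insert_eq] at this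
    exact .impIntro this
  | impElim _ _ ih₁ ih₂ => exact .impElim (ih₁ σ) (ih₂ σ)
  | byContra _ ih =>
    have := ih σ
    rw [Set.image_insert_eq] at this
    exact .byContra this
  | @allIntro Γ φ _ ih =>
    refine Derivable.allIntro (φ := fsub₁ φ σ) ?_
    have := ih (shiftSub σ)
    rw [instFresh_fsub₁, Set.image_image] at this
    simp only [shift_fsub] at this
    rwa [Set.image_image]
  | allElim t _ ih =>
    rw [inst_fsub₁]
    exact .allElim _ (ih σ)
  | eqRefl t => exact .eqRefl _
  | eqSubst _ _ ih₁ ih₂ =>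
    have h₁ := ih₁ σ
    have h₂ := ih₂ σ
    rw [inst_fsub₁] at h₂ ⊢
    exact .eqSubst h₁ h₂

end FOProof

namespace FOProof

universe u v
variable {L : FirstOrder.Language.{u, v}}

/-! ### The completeness theorem -/

/-- Only variables `xᵢ` with `i < N` occur free in `φ` (apart from those indexed by `Fin n`). -/
def VarsBelow (N : ℕ) {n : ℕ} (φ : L.BoundedFormula ℕ n) : Prop :=
  ∀ ⦃k : ℕ⦄ (σ τ : ℕ ⊕ Fin n → L.Term (ℕ ⊕ Fin k)), (∀ i < N, σ (Sum.inl i) = τ (Sum.inl i)) →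
    (∀ j, σ (Sum.inr j) = τ (Sum.inr j)) → sub φ σ = sub φ τ

theorem VarsBelow.mono {N N' n : ℕ} {φ : L.BoundedFormula ℕ n} (h : VarsBelow N φ)
    (hN : N ≤ N') : VarsBelow N' φ :=
  fun _ σ τ h₁ h₂ => h σ τ (fun i hi => h₁ i (hi.trans_le hN)) h₂

theorem exists_varsBelow_term {n : ℕ} (t : L.Term (ℕ ⊕ Fin n)) :
    ∃ N, ∀ N' ≥ N, ∀ ⦃k : ℕ⦄ (σ τ : ℕ ⊕ Fin n → L.Term (ℕ ⊕ Fin k)),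
      (∀ i < N', σ (Sum.inl i) = τ (Sum.inl i)) →
      (∀ j, σ (Sum.inr j) = τ (Sum.inr j)) → t.subst σ = t.subst τ := by
  induction t with
  | var a =>
    rcases a with i | j
    · exact ⟨i + 1, fun N' hN' k σ τ h₁ _ => h₁ i hN'⟩
    · exact ⟨0, fun N' _ k σ τ _ h₂ => h₂ j⟩
  | func f ts ih =>
    choose N hN using ih
    refine ⟨Finset.univ.sup N, fun N' hN' k σ τ h₁ h₂ => ?_⟩
    simp only [Term.subst]
    congr 1
    funext i
    exact hN i N' ((Finset.le_sup (Finset.mem_univ i)).trans hN') σ τ h₁ h₂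

theorem exists_varsBelow {n : ℕ} (φ : L.BoundedFormula ℕ n) : ∃ N, VarsBelow N φ := by
  induction φ with
  | falsum => exact ⟨0, fun _ _ _ _ _ => rfl⟩
  | equal t u =>
    obtain ⟨N₁, h₁⟩ := exists_varsBelow_term t
    obtain ⟨N₂, h₂⟩ := exists_varsBelow_term u
    refine ⟨max N₁ N₂, fun k σ τ h₃ h₄ => ?_⟩
    simp only [sub]
    rw [h₁ _ (le_max_left _ _) σ τ h₃ h₄, h₂ _ (le_max_right _ _) σ τ h₃ h₄]
  | rel R ts =>
    choose N hN using fun i => exists_varsBelow_term (ts i)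
    refine ⟨Finset.univ.sup N, fun k σ τ h₁ h₂ => ?_⟩
    simp only [sub]
    congr 1
    funext i
    exact hN i _ (Finset.le_sup (Finset.mem_univ i)) σ τ h₁ h₂
  | imp φ ψ ih₁ ih₂ =>
    obtain ⟨N₁, h₁⟩ := ih₁
    obtain ⟨N₂, h₂⟩ := ih₂
    refine ⟨max N₁ N₂, fun k σ τ h₃ h₄ => ?_⟩
    simp only [sub]
    rw [h₁.mono (le_max_left _ _) σ τ h₃ h₄, h₂.mono (le_max_right _ _) σ τ h₃ h₄]
  | all φ ih =>
    obtain ⟨N, h⟩ := ih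
    refine ⟨N, fun k σ τ h₁ h₂ => ?_⟩
    simp only [sub]
    rw [h (liftSub σ) (liftSub τ)]
    · intro i hi
      simp only [liftSub, Sum.elim_inl, h₁ i hi]
    · intro j
      induction j using Fin.lastCases with
      | last => simp [liftSub]
      | cast j => simp [liftSub, h₂ j]

theorem varsBelow_ofSentence (φ : L.Sentence) : VarsBelow 0 (ofSentence φ) := by
  intro k σ τ _ _
  simp only [ofSentence, sub_sub]
  congr 1
  funext a
  rcases a with a | a
  · exact a.elim
  · exact a.elim0

/-- `Γ` does not derive `⊥`. -/
def Consistent (Γ : Set (L.Formula ℕ)) : Prop := ¬ Derivable Γ .falsum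

theorem Consistent.sUnion {c : Set (Set (L.Formula ℕ))} (hc : IsChain (· ⊆ ·) c)
    (hne : c.Nonempty) (h : ∀ Γ ∈ c, Consistent Γ) : Consistent (⋃₀ c) := by
  intro hd
  obtain ⟨Γ₀, h₁, h₂, h₃⟩ := hd.compact
  obtain ⟨Γ, h₄, h₅⟩ :=
    hc.directedOn.exists_mem_subset_of_finite_of_subset_sUnion hne h₂ h₁
  exact h Γ h₄ (h₃.mono h₅)

theorem Derivable.exFalso {Γ : Set (L.Formula ℕ)} (φ : L.Formula ℕ) (h : Derivable Γ .falsum) :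
    Derivable Γ φ :=
  .byContra (h.mono (Set.subset_insert _ _))

/-- The formula `φ(xₘ) → ∀ z, φ(z)`. -/
def henkin (φ : L.BoundedFormula ℕ 1) (m : ℕ) : L.Formula ℕ :=
  BoundedFormula.imp (inst φ (Term.var (Sum.inl m))) (BoundedFormula.all φ)

theorem varsBelow_henkin {φ : L.BoundedFormula ℕ 1} {m : ℕ} (h : VarsBelow m φ) :
    VarsBelow (m + 1) (henkin φ m) := by
  intro k σ τ h₁ h₂
  simp only [henkin, sub, inst, sub_sub]
  congr 1
  · refine h _ _ (fun i hi => ?_) fun j => ?_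
    · exact h₁ i (hi.trans m.lt_succ_self)
    · exact h₁ m m.lt_succ_self
  · rw [h (liftSub σ) (liftSub τ)]
    · intro i hi
      simp only [liftSub, Sum.elim_inl, h₁ i (hi.trans m.lt_succ_self)]
    · intro j
      rw [Subsingleton.elim j (Fin.last 0)]
      simp only [liftSub, Sum.elim_inr, Fin.snoc_last]

/-- The rule `allIntro` has the fixed eigenvariable `x₀`. Renaming `xₘ` to `x₀` and every other `xᵢ`
to `xᵢ₊₁` turns the given derivation into its premise. -/
theorem Derivable.all_of_fresh {Γ : Set (L.Formula ℕ)} {φ : L.BoundedFormula ℕ 1} {m : ℕ}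
    (hΓ : ∀ ψ ∈ Γ, VarsBelow m ψ) (hφ : VarsBelow m φ)
    (h : Derivable Γ (inst φ (Term.var (Sum.inl m)))) : Derivable Γ (BoundedFormula.all φ) := by
  refine .allIntro ?_
  have := h.fsub (fun i => Term.var (Sum.inl (if i = m then 0 else i + 1)))
  have h₁ : FOProof.fsub (inst φ (Term.var (Sum.inl m)))
      (fun i => Term.var (Sum.inl (if i = m then 0 else i + 1))) = instFresh φ := by
    simp only [FOProof.fsub, inst, instFresh, sub_sub]
    refine hφ _ _ (fun i hi => ?_) fun j => ?_
    · simp [Term.subst, hi.ne]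
    · simp [Term.subst]
  rw [h₁] at this
  refine this.mono ?_
  rintro _ ⟨ψ, hψ, rfl⟩
  refine ⟨ψ, hψ, ?_⟩
  refine hΓ ψ hψ _ _ (fun i hi => ?_) fun j => j.elim0
  simp [hi.ne]

/-- If `Γ` refuted φ(xₘ) → ∀ z, φ(z), it would derive φ(xₘ) and also refute ∀ z, φ(z); but `xₘ` is
fresh, so φ(xₘ) generalizes. -/
theorem Consistent.insert_henkin {Γ : Set (L.Formula ℕ)} {φ : L.BoundedFormula ℕ 1} {m : ℕ}
    (h : Consistent Γ) (hΓ : ∀ ψ ∈ Γ, VarsBelow m ψ) (hφ : VarsBelow m φ) :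
    Consistent (insert (henkin φ m) Γ) := by
  intro hd
  have h₁ : Derivable Γ (BoundedFormula.imp (henkin φ m) .falsum) := .impIntro hd
  have h₂ : Derivable Γ (inst φ (Term.var (Sum.inl m))) := by
    refine .byContra (.impElim (h₁.mono (Set.subset_insert _ _)) (.impIntro (.exFalso _ ?_)))
    exact .impElim (.hyp (Set.mem_insert_of_mem _ (Set.mem_insert _ _)))
      (.hyp (Set.mem_insert _ _))
  refine h (.impElim h₁ (.impIntro ?_))
  exact (Derivable.all_of_fresh hΓ hφ h₂).mono (Set.subset_insert _ _)

/-- Maximal consistent sets with witnesses for universal quantifiers. -/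
structure IsHenkin (Δ : Set (L.Formula ℕ)) : Prop where
  closed : ∀ φ, Derivable Δ φ → φ ∈ Δ
  falsum_notMem : BoundedFormula.falsum ∉ Δ
  imp_mem : ∀ φ ψ : L.Formula ℕ, φ.imp ψ ∈ Δ ↔ (φ ∈ Δ → ψ ∈ Δ)
  all_mem : ∀ φ : L.BoundedFormula ℕ 1, BoundedFormula.all φ ∈ Δ ↔ ∀ t, inst φ t ∈ Δ

theorem Consistent.exists_maximal {Γ : Set (L.Formula ℕ)} (h : Consistent Γ) :
    ∃ Δ, Γ ⊆ Δ ∧ Maximal (fun Δ => Consistent Δ) Δ :=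
  zorn_subset_nonempty {Δ : Set (L.Formula ℕ) | Consistent Δ}
    (fun c hc hchain hne => ⟨⋃₀ c, Consistent.sUnion hchain hne hc,
      fun _ hs => Set.subset_sUnion_of_mem hs⟩) Γ h

theorem isHenkin_of_maximal {Δ : Set (L.Formula ℕ)} (h : Maximal (fun Δ => Consistent Δ) Δ)
    (hw : ∀ φ, ∃ m, henkin φ m ∈ Δ) : IsHenkin Δ := by
  have mem_of : ∀ φ, Consistent (insert φ Δ) → φ ∈ Δ := fun φ hφ =>
    h.2 hφ (Set.subset_insert _ _) (Set.mem_insert _ _)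
  have closed : ∀ φ, Derivable Δ φ → φ ∈ Δ := fun φ hφ =>
    mem_of φ fun hd => h.1 (.impElim (.impIntro hd) hφ)
  refine ⟨closed, fun hd => h.1 (.hyp hd), fun φ ψ => ⟨fun h₁ h₂ =>
    closed _ (.impElim (.hyp h₁) (.hyp h₂)), fun h₁ => ?_⟩, fun φ => ⟨fun h₁ t =>
    closed _ (.allElim t (.hyp h₁)), fun h₁ => ?_⟩⟩
  · refine closed _ (.impIntro ?_)
    by_cases hφ : φ ∈ Δ
    · exact .hyp (Set.mem_insert_of_mem _ (h₁ hφ))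
    · by_contra hd
      refine hφ (mem_of φ fun hd' => hd (.exFalso _ hd'))
  · obtain ⟨m, hm⟩ := hw φ
    exact closed _ (.impElim (.hyp hm) (.hyp (h₁ _)))

/-- The free variables themselves play the role of Henkin constants: `Γ` uses none of them, and
countability allows the formulas to be treated one at a time. -/
theorem exists_isHenkin [Countable L.Symbols] {Γ : Set (L.Formula ℕ)} (h : Consistent Γ)
    (hΓ : ∀ ψ ∈ Γ, VarsBelow 0 ψ) : ∃ Δ, Γ ⊆ Δ ∧ IsHenkin Δ := by
  have : Countable (L.BoundedFormula ℕ 1) :=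
    (sigma_mk_injective (β := L.BoundedFormula ℕ) (i := 1)).countable
  have : Nonempty (L.BoundedFormula ℕ 1) := ⟨.falsum⟩
  obtain ⟨φ, hφ⟩ := exists_surjective_nat (L.BoundedFormula ℕ 1)
  choose N hN using fun k => exists_varsBelow (φ k)
  -- `m k` lies above the variables of `φ k` and above all earlier witnesses, so `x_{m k}` is fresh
  -- at stage `k`.
  let m : ℕ → ℕ := fun k => Nat.rec (N 0) (fun k a => max (a + 1) (N (k + 1))) k
  have hm : ∀ k, VarsBelow (m k) (φ k) := by
    intro k
    cases k with
    | zero => exact hN 0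
    | succ k => exact (hN (k + 1)).mono (le_max_right _ _)
  let G : ℕ → Set (L.Formula ℕ) := fun k =>
    Nat.rec Γ (fun k A => insert (henkin (φ k) (m k)) A) k
  have hG : ∀ k, Consistent (G k) ∧ ∀ ψ ∈ G k, VarsBelow (m k) ψ := by
    intro k
    induction k with
    | zero => exact ⟨h, fun ψ hψ => (hΓ ψ hψ).mono (Nat.zero_le _)⟩
    | succ k ih =>
      refine ⟨ih.1.insert_henkin ih.2 (hm k), ?_⟩
      have hlt : m k + 1 ≤ m (k + 1) := le_max_left _ _
      rintro ψ (rfl | hψ)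
      · exact (varsBelow_henkin (hm k)).mono hlt
      · exact (ih.2 ψ hψ).mono (m k |>.le_succ.trans hlt)
  have hmono : Monotone G := monotone_nat_of_le_succ fun k => Set.subset_insert _ _
  have hU : Consistent (⋃₀ Set.range G) :=
    Consistent.sUnion hmono.isChain_range (Set.range_nonempty _)
      (by rintro _ ⟨k, rfl⟩; exact (hG k).1)
  obtain ⟨Δ, h₁, h₂⟩ := hU.exists_maximal
  refine ⟨Δ, (Set.subset_sUnion_of_mem (Set.mem_range_self 0)).trans h₁,
    isHenkin_of_maximal h₂ fun ψ => ?_⟩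
  obtain ⟨k, rfl⟩ := hφ ψ
  exact ⟨m k, h₁ ⟨G (k + 1), ⟨k + 1, rfl⟩, Set.mem_insert _ _⟩⟩

/-! ### The term model of a Henkin set. -/

namespace IsHenkin

variable {Δ : Set (L.Formula ℕ)}

theorem rewrite (h : IsHenkin Δ) {t u : L.Term (ℕ ⊕ Fin 0)} (φ : L.BoundedFormula ℕ 1)
    (htu : BoundedFormula.equal t u ∈ Δ) (ht : inst φ t ∈ Δ) : inst φ u ∈ Δ :=
  h.closed _ (.eqSubst (.hyp htu) (.hyp ht))

theorem relabel_subst_self {n : ℕ} (s : L.Term (ℕ ⊕ Fin 0)) (g : Fin 0 → Fin n)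
    (σ : Fin n → L.Term (ℕ ⊕ Fin 0)) :
    (s.relabel (Sum.map id g)).subst (Sum.elim (fun i => Term.var (Sum.inl i)) σ) = s := by
  rw [relabel_subst]
  conv_rhs => rw [← subst_var s]
  congr 1
  funext b
  rcases b with b | b
  · rfl
  · exact b.elim0

/-- Provable equality of terms. -/
def setoid (h : IsHenkin Δ) : Setoid (L.Term (ℕ ⊕ Fin 0)) where
  r t u := BoundedFormula.equal t u ∈ Δ
  iseqv := by
    have hr : ∀ t : L.Term (ℕ ⊕ Fin 0), BoundedFormula.equal t t ∈ Δ :=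
      fun t => h.closed _ (.eqRefl t)
    have ht : ∀ {s t u : L.Term (ℕ ⊕ Fin 0)}, BoundedFormula.equal s t ∈ Δ →
        BoundedFormula.equal t u ∈ Δ → BoundedFormula.equal s u ∈ Δ := by
      intro s t u h₁ h₂
      have := h.rewrite (BoundedFormula.equal (up s) (Term.var (Sum.inr 0))) h₂
      simp only [inst, sub, up, relabel_subst_self] at this
      exact this h₁
    refine ⟨hr, fun {t u} h₁ => ?_, ht⟩
    have h₂ := h.rewrite (BoundedFormula.equal (Term.var (Sum.inr 0)) (up t)) h₁
    simp only [inst, sub, up, relabel_subst_self] at h₂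
    exact h₂ (hr t)

/-- The rule `eqSubst` replaces one term only, so `σ` is turned into `τ` coordinate by coordinate,
by induction on the set of coordinates already changed. -/
theorem sub_congr (h : IsHenkin Δ) {n : ℕ} (φ : L.BoundedFormula ℕ n)
    (σ τ : Fin n → L.Term (ℕ ⊕ Fin 0)) (hστ : ∀ i, BoundedFormula.equal (σ i) (τ i) ∈ Δ)
    (hσ : sub φ (Sum.elim (fun i => Term.var (Sum.inl i)) σ) ∈ Δ) :
    sub φ (Sum.elim (fun i => Term.var (Sum.inl i)) τ) ∈ Δ := by
  classical
  have step : ∀ (ρ : Fin n → L.Term (ℕ ⊕ Fin 0)) (j : Fin n) (t : L.Term (ℕ ⊕ Fin 0)),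
      inst (sub φ (Sum.elim (fun i => Term.var (Sum.inl i))
        (Function.update (fun i => up (ρ i)) j (Term.var (Sum.inr 0))))) t =
      sub φ (Sum.elim (fun i => Term.var (Sum.inl i)) (Function.update ρ j t)) := by
    intro ρ j t
    simp only [inst, sub_sub]
    congr 1
    funext a
    rcases a with a | i
    · rfl
    · by_cases hij : i = j
      · subst hij
        simp [Term.subst]
      · simp only [Sum.elim_inr, Function.update_of_ne hij]
        exact relabel_subst_self _ _ _
  have main : ∀ s : Finset (Fin n),
      sub φ (Sum.elim (fun i => Term.var (Sum.inl i)) (s.piecewise τ σ)) ∈ Δ := by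
    intro s
    induction s using Finset.induction_on with
    | empty => simpa using hσ
    | insert j s hj ih =>
      rw [Finset.piecewise_insert, ← step]
      refine h.rewrite _ (hστ j) ?_
      rw [step]
      convert ih using 3
      rw [Function.update_eq_self_iff]
      simp [hj]
  simpa using main Finset.univ

/-- The universe of the term model. -/
def Model (h : IsHenkin Δ) : Type u := Quotient h.setoid

/-- The value of a term in the term model. -/
def cls (h : IsHenkin Δ) (t : L.Term (ℕ ⊕ Fin 0)) : h.Model := Quotient.mk h.setoid t

/-- A representative of an element of the term model. -/
noncomputable def rep (h : IsHenkin Δ) (a : h.Model) : L.Term (ℕ ⊕ Fin 0) := Quotient.out a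

theorem cls_eq_cls (h : IsHenkin Δ) {t u : L.Term (ℕ ⊕ Fin 0)} :
    h.cls t = h.cls u ↔ BoundedFormula.equal t u ∈ Δ :=
  Quotient.eq (r := h.setoid)

theorem cls_rep (h : IsHenkin Δ) (a : h.Model) : h.cls (h.rep a) = a := Quotient.out_eq a

noncomputable instance (h : IsHenkin Δ) : L.Structure h.Model where
  funMap f a := h.cls (Term.func f fun i => h.rep (a i))
  RelMap R a := BoundedFormula.rel R (fun i => h.rep (a i)) ∈ Δ

theorem rep_mk_mem (h : IsHenkin Δ) (t : L.Term (ℕ ⊕ Fin 0)) :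
    BoundedFormula.equal (h.rep (h.cls t)) t ∈ Δ :=
  h.cls_eq_cls.1 (h.cls_rep _)

theorem mem_rep_mk (h : IsHenkin Δ) (t : L.Term (ℕ ⊕ Fin 0)) :
    BoundedFormula.equal t (h.rep (h.cls t)) ∈ Δ :=
  h.cls_eq_cls.1 (h.cls_rep _).symm

/-- Independence of representatives: the structure is defined through the chosen `rep`, and
`sub_congr` allows any other terms of the same classes. -/
theorem cls_func (h : IsHenkin Δ) {n : ℕ} (f : L.Functions n) (ts : Fin n → L.Term (ℕ ⊕ Fin 0)) :
    Structure.funMap f (fun i => h.cls (ts i)) = h.cls (Term.func f ts) := by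
  refine h.cls_eq_cls.2 ?_
  have := h.sub_congr (BoundedFormula.equal
    ((Term.func f fun i => h.rep (h.cls (ts i))).relabel (Sum.map id Fin.elim0))
    (Term.func f fun i => Term.var (Sum.inr i))) _ _ (fun i => h.rep_mk_mem (ts i))
  simp only [sub, relabel_subst_self] at this
  exact this (h.closed _ (.eqRefl _))

theorem rel_mem (h : IsHenkin Δ) {n : ℕ} (R : L.Relations n)
    (ts : Fin n → L.Term (ℕ ⊕ Fin 0)) :
    Structure.RelMap R (fun i => h.cls (ts i)) ↔ BoundedFormula.rel R ts ∈ Δ :=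
  ⟨h.sub_congr (.rel R fun i => Term.var (Sum.inr i)) _ _ fun i => h.rep_mk_mem (ts i),
    h.sub_congr (.rel R fun i => Term.var (Sum.inr i)) _ _ fun i => h.mem_rep_mk (ts i)⟩

theorem realize_term (h : IsHenkin Δ) {γ : Type} (t : L.Term γ) (σ : γ → L.Term (ℕ ⊕ Fin 0)) :
    t.realize (fun a => h.cls (σ a)) = h.cls (t.subst σ) := by
  induction t with
  | var => rfl
  | func f ts ih => simp only [Term.realize, ih, Term.subst, h.cls_func]

/-- The assignment of the free variables to their classes in the term model. -/
def val (h : IsHenkin Δ) (i : ℕ) : h.Model := h.cls (Term.var (Sum.inl i))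

/-- The truth lemma. Allowing arbitrary terms `σ` for the bound variables makes the quantifier case
work, since every element of the model is the class of a term. -/
theorem realize_iff_mem (h : IsHenkin Δ) {n : ℕ} (φ : L.BoundedFormula ℕ n)
    (σ : Fin n → L.Term (ℕ ⊕ Fin 0)) :
    φ.Realize h.val (fun j => h.cls (σ j)) ↔
      sub φ (Sum.elim (fun i => Term.var (Sum.inl i)) σ) ∈ Δ := by
  have key : ∀ {n : ℕ} (σ : Fin n → L.Term (ℕ ⊕ Fin 0)) (t : L.Term (ℕ ⊕ Fin n)),
      t.realize (Sum.elim h.val (fun j => h.cls (σ j))) =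
      h.cls (t.subst (Sum.elim (fun i => Term.var (Sum.inl i)) σ)) := by
    intro n σ t
    rw [← realize_term]
    congr 1
    funext a
    rcases a with a | a <;> rfl
  induction φ with
  | falsum => exact iff_of_false id h.falsum_notMem
  | equal t u => simp only [BoundedFormula.Realize, sub, key, h.cls_eq_cls]
  | rel R ts => simp only [BoundedFormula.Realize, sub, key, h.rel_mem]
  | imp φ ψ ih₁ ih₂ => simp only [BoundedFormula.Realize, sub, ih₁, ih₂, h.imp_mem]
  | all φ ih =>
    simp only [BoundedFormula.Realize, sub, h.all_mem]
    have hsurj : ∀ a : h.Model, ∃ t, h.cls t = a := fun a => ⟨_, h.cls_rep a⟩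
    rw [(show Function.Surjective h.cls from hsurj).forall]
    refine forall_congr' fun t => ?_
    have h₁ : (Fin.snoc (fun j => h.cls (σ j)) (h.cls t) : Fin _ → h.Model) =
        fun j => h.cls ((Fin.snoc σ t : Fin _ → L.Term (ℕ ⊕ Fin 0)) j) := by
      funext j
      induction j using Fin.lastCases <;> simp
    rw [h₁]
    refine (ih _).trans ?_
    rw [inst, sub_sub]
    refine iff_of_eq (congrArg (· ∈ Δ) (congrArg _ ?_))
    funext a
    rcases a with a | j
    · rfl
    · induction j using Fin.lastCases with
      | last => simp [liftSub, Term.subst]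
      | cast j =>
        simp only [Sum.elim_inr, liftSub, Fin.snoc_castSucc]
        exact (relabel_subst_self _ _ _).symm

theorem realize_sentence (h : IsHenkin Δ) (φ : L.Sentence) :
    Sentence.Realize h.Model φ ↔ ofSentence φ ∈ Δ := by
  rw [← realize_ofSentence φ h.val default,
    Subsingleton.elim (default : Fin 0 → h.Model) fun j => h.cls (Fin.elim0 j), realize_iff_mem]
  refine iff_of_eq (congrArg (· ∈ Δ) ?_)
  conv_rhs => rw [← sub_var (ofSentence φ)]
  congr 1
  funext a
  rcases a with a | a
  · rfl
  · exact a.elim0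

end IsHenkin

/-- **Gödel's completeness theorem** for countable languages. -/
theorem proves_of_forall_model [Countable L.Symbols] {T : L.Theory} {φ : L.Sentence}
    (h : ∀ (M : Type u) [L.Structure M] [Nonempty M],
      (∀ ψ ∈ T, Sentence.Realize M ψ) → Sentence.Realize M φ) : Proves T φ := by
  -- If the negation of `φ` were consistent with `T`, the term model of a Henkin extension would
  -- satisfy `T` and refute `φ`.
  refine .byContra ?_
  by_contra hd
  obtain ⟨Δ, h₁, hΔ⟩ := exists_isHenkin (Γ := insert (ofSentence φ.not) (ofSentence '' T)) hd (by
    rintro ψ (rfl | ⟨ψ, _, rfl⟩) <;> exact varsBelow_ofSentence _)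
  have : Nonempty hΔ.Model := ⟨hΔ.val 0⟩
  have h₂ := h hΔ.Model fun ψ hψ =>
    (hΔ.realize_sentence ψ).2 (h₁ (Set.mem_insert_of_mem _ ⟨ψ, hψ, rfl⟩))
  exact (hΔ.realize_sentence φ.not).2 (h₁ (Set.mem_insert _ _)) h₂

end FOProof

namespace Arith

open FOProof

/-! ### Models of Peano arithmetic -/

theorem func_countable (l : ℕ) : Countable (Func l) := by
  let f : Func l → ℕ := fun g => match g with
    | .zero => 0
    | .succ => 0
    | .add => 0
    | .mul => 1
  refine Function.Injective.countable (f := f) ?_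
  intro a b h
  cases a <;> cases b <;> first | rfl | simp [f] at h

instance : Countable LA.Symbols := by
  have h₁ : ∀ l, Countable (LA.Functions l) := func_countable
  have h₂ : ∀ l, Countable (LA.Relations l) := fun l =>
    Function.Injective.countable (f := fun _ : Rel l => 0) (by
      rintro ⟨⟩ ⟨⟩ _
      rfl)
  unfold Language.Symbols
  infer_instance

section Operations
variable (M : Type) [LA.Structure M]

/-- Interpretation of `0` in a structure. -/
def zeroM : M := Structure.funMap (L := LA) Func.zero ![]

variable {M}

/-- Interpretation of `S` in a structure. -/
def succM (a : M) : M := Structure.funMap (L := LA) Func.succ ![a]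

/-- Interpretation of `+` in a structure. -/
def addM (a b : M) : M := Structure.funMap (L := LA) Func.add ![a, b]

/-- Interpretation of `·` in a structure. -/
def mulM (a b : M) : M := Structure.funMap (L := LA) Func.mul ![a, b]

/-- Interpretation of `<` in a structure. -/
def ltM (a b : M) : Prop := Structure.RelMap (L := LA) Rel.lt ![a, b]

variable (M) in
/-- Interpretation of numerals in a structure. -/
def numM : ℕ → M
  | 0 => zeroM M
  | k + 1 => succM (numM k)

variable (M) in
/-- The assignment of no variables. -/
abbrev noVars : Empty → M := default

variable {γ : Type} {n : ℕ}

theorem comp_vec₁ {α β : Type*} (f : α → β) (a : α) : (fun i => f (![a] i)) = ![f a] := by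
  funext i
  fin_cases i
  rfl

theorem comp_vec₂ {α β : Type*} (f : α → β) (a b : α) :
    (fun i => f (![a, b] i)) = ![f a, f b] := by
  funext i
  fin_cases i <;> rfl

theorem comp_vec₃ {α β : Type*} (f : α → β) (a b c : α) :
    (fun i => f (![a, b, c] i)) = ![f a, f b, f c] := by
  funext i
  fin_cases i <;> rfl

@[simp] theorem realize_zero (v : γ → M) : (zero : LA.Term γ).realize v = zeroM M :=
  congrArg (Structure.funMap (L := LA) Func.zero) (Subsingleton.elim _ _)

@[simp] theorem realize_succ (v : γ → M) (t : LA.Term γ) :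
    (succ t).realize v = succM (t.realize v) :=
  congrArg (Structure.funMap (L := LA) Func.succ) (comp_vec₁ (fun t => t.realize v) t)

@[simp] theorem realize_add (v : γ → M) (t u : LA.Term γ) :
    (add t u).realize v = addM (t.realize v) (u.realize v) :=
  congrArg (Structure.funMap (L := LA) Func.add) (comp_vec₂ (fun t => t.realize v) t u)

@[simp] theorem realize_mul (v : γ → M) (t u : LA.Term γ) :
    (mul t u).realize v = mulM (t.realize v) (u.realize v) :=
  congrArg (Structure.funMap (L := LA) Func.mul) (comp_vec₂ (fun t => t.realize v) t u)

@[simp] theorem realize_num (v : γ → M) (k : ℕ) : (num k : LA.Term γ).realize v = numM M k := by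
  induction k with
  | zero => exact realize_zero v
  | succ k ih => rw [num, realize_succ, ih, numM]

@[simp] theorem realize_x (v : Empty → M) (xs : Fin n → M) (i : Fin n) :
    (x i).realize (Sum.elim v xs) = xs i := rfl

@[simp] theorem realize_lt (v : Empty → M) (xs : Fin n → M) (t u : LA.Term (Empty ⊕ Fin n)) :
    (lt t u).Realize v xs ↔ ltM (t.realize (Sum.elim v xs)) (u.realize (Sum.elim v xs)) :=
  iff_of_eq (congrArg (Structure.RelMap (L := LA) Rel.lt)
    (comp_vec₂ (fun t => t.realize (Sum.elim v xs)) t u))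

@[simp] theorem realize_eq (v : Empty → M) (xs : Fin n → M) (t u : LA.Term (Empty ⊕ Fin n)) :
    (eq t u).Realize v xs ↔ t.realize (Sum.elim v xs) = u.realize (Sum.elim v xs) := Iff.rfl

@[simp] theorem realize_app {k : ℕ} (v : Empty → M) (xs : Fin n → M)
    (φ : LA.BoundedFormula Empty k) (t : Fin k → LA.Term (Empty ⊕ Fin n)) :
    (app φ t).Realize v xs ↔ φ.Realize v fun i => (t i).realize (Sum.elim v xs) := by
  rw [app, realize_sub]
  exact iff_of_eq (congrArg₂ _ (Subsingleton.elim _ _) rfl)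

attribute [simp] realize_up

theorem realize_induction (φ : LA.BoundedFormula Empty (n + 1)) :
    Sentence.Realize M (induction φ) ↔ ∀ xs : Fin n → M,
      φ.Realize default (Fin.snoc xs (zeroM M) : Fin (n + 1) → M) →
      (∀ a, φ.Realize default (Fin.snoc xs a : Fin (n + 1) → M) →
        φ.Realize default (Fin.snoc xs (succM a) : Fin (n + 1) → M)) →
      ∀ a, φ.Realize default (Fin.snoc xs a : Fin (n + 1) → M) := by
  rw [induction, Sentence.Realize, BoundedFormula.realize_alls]
  refine forall_congr' fun xs => ?_
  have h : ∀ (m : ℕ) (ys : Fin m → M) (u : Fin n → LA.Term (Empty ⊕ Fin m))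
      (t : LA.Term (Empty ⊕ Fin m)),
      (fun i => ((Fin.snoc u t : Fin (n + 1) → LA.Term (Empty ⊕ Fin m)) i).realize
        (Sum.elim (default : Empty → M) ys)) =
      (Fin.snoc (fun i => (u i).realize (Sum.elim default ys))
        (t.realize (Sum.elim default ys)) : Fin (n + 1) → M) := by
    intro m ys u t
    funext i
    induction i using Fin.lastCases <;> simp
  simp only [BoundedFormula.realize_imp, BoundedFormula.realize_all, realize_app, h, realize_zero,
    realize_succ, realize_x, Fin.snoc_castSucc, Fin.snoc_last]

end Operations

/-- `M` is a model of Peano arithmetic. -/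
class IsModelPA (M : Type) [LA.Structure M] : Prop where
  realize : ∀ ψ ∈ PA, Sentence.Realize M ψ

section Model
variable {M : Type} [LA.Structure M] [IsModelPA M]

theorem realize_axiom {φ : LA.Sentence} (h : PAAxiom φ) :
    BoundedFormula.Realize φ (default : Empty → M) default := IsModelPA.realize φ h

theorem succM_ne_zeroM (a : M) : succM a ≠ zeroM M := by
  simpa [Fin.snoc] using realize_axiom (M := M) .succ_ne_zero a

theorem succM_inj {a b : M} (h : succM a = succM b) : a = b := by
  have := realize_axiom (M := M) .succ_inj a b
  simp [Fin.snoc] at this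
  exact this h

theorem addM_zeroM (a : M) : addM a (zeroM M) = a := by
  simpa [Fin.snoc] using realize_axiom (M := M) .add_zero a

theorem addM_succM (a b : M) : addM a (succM b) = succM (addM a b) := by
  simpa [Fin.snoc] using realize_axiom (M := M) .add_succ a b

theorem mulM_zeroM (a : M) : mulM a (zeroM M) = zeroM M := by
  simpa [Fin.snoc] using realize_axiom (M := M) .mul_zero a

theorem mulM_succM (a b : M) : mulM a (succM b) = addM (mulM a b) a := by
  simpa [Fin.snoc] using realize_axiom (M := M) .mul_succ a b

theorem not_ltM_zeroM (a : M) : ¬ ltM a (zeroM M) := by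
  simpa [Fin.snoc] using realize_axiom (M := M) .not_lt_zero a

theorem ltM_succM {a b : M} : ltM a (succM b) ↔ ltM a b ∨ a = b := by
  simpa [Fin.snoc] using realize_axiom (M := M) .lt_succ a b

theorem induct {n : ℕ} (φ : LA.BoundedFormula Empty (n + 1)) (xs : Fin n → M)
    (h₀ : φ.Realize default (Fin.snoc xs (zeroM M) : Fin (n + 1) → M))
    (h₁ : ∀ a, φ.Realize default (Fin.snoc xs a : Fin (n + 1) → M) →
        φ.Realize default (Fin.snoc xs (succM a) : Fin (n + 1) → M)) (a : M) :
    φ.Realize default (Fin.snoc xs a : Fin (n + 1) → M) :=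
  (realize_induction φ).1 (IsModelPA.realize _ (.ind φ)) xs h₀ h₁ a

/-- The axioms for `<` are a recursion on its right argument, so this and the next order laws go by
induction on a right-hand argument. -/
theorem zeroM_le (a : M) : ltM (zeroM M) a ∨ zeroM M = a := by
  have := induct (M := M) (n := 0) (lt zero (x 0) ⊔ eq zero (x 0)) ![]
  simp at this
  refine this (fun a h => Or.inl (ltM_succM.2 h)) a

theorem ltM_trans {a b c : M} (hab : ltM a b) : ltM b c → ltM a c := by
  have := induct (M := M) (n := 2) ((lt (x 1) (x 2)).imp (lt (x 0) (x 2))) ![a, b]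
  simp at this
  refine this (fun h => (not_ltM_zeroM _ h).elim) (fun c ih h => ltM_succM.2 (Or.inl ?_)) c
  rcases ltM_succM.1 h with h | rfl
  exacts [ih h, hab]

theorem succM_le {a b : M} : ltM a b → ltM (succM a) b ∨ succM a = b := by
  have := induct (M := M) (n := 1)
    ((lt (x 0) (x 1)).imp (lt (succ (x 0)) (x 1) ⊔ eq (succ (x 0)) (x 1))) ![a]
  simp at this
  refine this (fun h => (not_ltM_zeroM _ h).elim) (fun b ih h => ?_) b
  rcases ltM_succM.1 h with h | rfl
  · exact Or.inl (ltM_succM.2 (ih h))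
  · exact Or.inr rfl

theorem ltM_trichotomy (a b : M) : ltM a b ∨ a = b ∨ ltM b a := by
  have := induct (M := M) (n := 1)
    (lt (x 0) (x 1) ⊔ (eq (x 0) (x 1) ⊔ lt (x 1) (x 0))) ![a]
  simp at this
  refine this (Or.inr ((zeroM_le a).symm.imp_left Eq.symm)) (fun b ih => ?_) b
  rcases ih with h | rfl | h
  · exact Or.inl (ltM_succM.2 (Or.inl h))
  · exact Or.inl (ltM_succM.2 (Or.inr rfl))
  · exact Or.inr ((succM_le h).symm.imp_left Eq.symm)

/-- The least number principle. -/
theorem exists_least {n : ℕ} (φ : LA.BoundedFormula Empty (n + 1)) (xs : Fin n → M) {a : M}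
    (ha : φ.Realize default (Fin.snoc xs a : Fin (n + 1) → M)) :
    ∃ b, φ.Realize default (Fin.snoc xs b : Fin (n + 1) → M) ∧
      ∀ c, ltM c b → ¬ φ.Realize default (Fin.snoc xs c : Fin (n + 1) → M) := by
  by_contra! hne
  -- Ordinary induction on "no element below `b` satisfies `φ`", read off at the successor of `a`.
  have := induct (M := M)
    ((lt (x (Fin.last (n + 1))) (x (Fin.last n).castSucc)).imp
      (app φ (Fin.snoc (α := fun _ => LA.Term (Empty ⊕ Fin (n + 2)))
        (fun i => x i.castSucc.castSucc) (x (Fin.last (n + 1))))).not).all xs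
  have h : ∀ b c : M, (fun i => ((Fin.snoc (α := fun _ => LA.Term (Empty ⊕ Fin (n + 2)))
      (fun i => x i.castSucc.castSucc) (x (Fin.last (n + 1)))) i).realize
        (Sum.elim (default : Empty → M) (Fin.snoc (Fin.snoc xs b) c))) =
      (Fin.snoc xs c : Fin (n + 1) → M) := by
    intro b c
    funext i
    induction i using Fin.lastCases <;> simp
  simp only [BoundedFormula.realize_all, BoundedFormula.realize_imp, realize_lt, realize_x,
    Fin.snoc_last, Fin.snoc_castSucc, BoundedFormula.realize_not, realize_app, h] at this
  refine this (fun c hc => (not_ltM_zeroM _ hc).elim) (fun b ih c hc hφ => ?_) (succM a) a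
    (ltM_succM.2 (Or.inr rfl)) ha
  rcases ltM_succM.1 hc with hc | rfl
  · exact ih c hc hφ
  · obtain ⟨d, hd, hd'⟩ := hne c hφ
    exact ih d hd hd'

/-! ### Numerals -/

theorem numM_injective : Function.Injective (numM M) := by
  intro a
  induction a with
  | zero =>
    rintro (_ | b) h
    · rfl
    · exact (succM_ne_zeroM _ h.symm).elim
  | succ a ih =>
    rintro (_ | b) h
    · exact (succM_ne_zeroM _ h).elim
    · rw [ih (succM_inj h)]

/-- The numerals form an initial segment of every model; the absoluteness of Δ₀ formulas rests on
this. -/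
theorem ltM_numM_iff {a : M} {k : ℕ} : ltM a (numM M k) ↔ ∃ j < k, a = numM M j := by
  induction k with
  | zero => simpa [numM] using not_ltM_zeroM a
  | succ k ih =>
    rw [numM, ltM_succM, ih]
    constructor
    · rintro (⟨j, hj, rfl⟩ | rfl)
      exacts [⟨j, hj.trans k.lt_succ_self, rfl⟩, ⟨k, k.lt_succ_self, rfl⟩]
    · rintro ⟨j, hj, rfl⟩
      rcases Nat.lt_succ_iff_lt_or_eq.1 hj with hj | rfl
      exacts [Or.inl ⟨j, hj, rfl⟩, Or.inr rfl]

theorem numM_ltM_numM {j k : ℕ} : ltM (numM M j) (numM M k) ↔ j < k := by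
  rw [ltM_numM_iff]
  constructor
  · rintro ⟨i, hi, h⟩
    rwa [numM_injective h]
  · exact fun h => ⟨j, h, rfl⟩

theorem addM_numM (j k : ℕ) : addM (numM M j) (numM M k) = numM M (j + k) := by
  induction k with
  | zero => exact addM_zeroM _
  | succ k ih => rw [numM, addM_succM, ih, ← add_assoc, numM]

theorem mulM_numM (j k : ℕ) : mulM (numM M j) (numM M k) = numM M (j * k) := by
  induction k with
  | zero => exact mulM_zeroM _
  | succ k ih => rw [numM, mulM_succM, ih, addM_numM, Nat.mul_succ]

theorem numM_ltM_of_nonstandard {a : M} (ha : ∀ k, a ≠ numM M k) (k : ℕ) : ltM (numM M k) a := by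
  rcases ltM_trichotomy (numM M k) a with h | h | h
  · exact h
  · exact (ha k h.symm).elim
  · obtain ⟨j, _, h⟩ := ltM_numM_iff.1 h
    exact (ha j h).elim

end Model

/-! ### The standard model -/

@[simp] theorem zeroM_nat : zeroM ℕ = 0 := rfl

@[simp] theorem succM_nat (a : ℕ) : succM a = a + 1 := rfl

@[simp] theorem addM_nat (a b : ℕ) : addM a b = a + b := rfl

@[simp] theorem mulM_nat (a b : ℕ) : mulM a b = a * b := rfl

@[simp] theorem ltM_nat (a b : ℕ) : ltM a b ↔ a < b := Iff.rfl

@[simp] theorem numM_nat (k : ℕ) : numM ℕ k = k := by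
  induction k with
  | zero => rfl
  | succ k ih => rw [numM, ih, succM_nat]

theorem realize_of_paAxiom_nat {φ : LA.Sentence} (h : PAAxiom φ) : Sentence.Realize ℕ φ := by
  cases h with
  | ind φ =>
    refine (realize_induction φ).2 fun xs h₀ h₁ a => ?_
    induction a with
    | zero => exact h₀
    | succ a ih => exact h₁ a ih
  | lt_succ => simp [Sentence.Realize, Formula.Realize, Fin.snoc, Nat.le_iff_lt_or_eq]
  | _ => simp [Sentence.Realize, Formula.Realize, Fin.snoc, mul_add, add_assoc]

instance : IsModelPA ℕ := ⟨fun _ h => realize_of_paAxiom_nat h⟩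

/-! ### Arithmetical formulas -/

section Absoluteness
variable (M : Type) [LA.Structure M] [IsModelPA M]

theorem realize_term_numM {γ : Type} (v : γ → ℕ) (t : LA.Term γ) :
    t.realize (fun a => numM M (v a)) = numM M (t.realize v) := by
  induction t with
  | var => rfl
  | @func l f ts ih =>
    simp only [Term.realize, ih]
    cases f with
    | zero => exact congrArg (Structure.funMap (L := LA) Func.zero) (Subsingleton.elim _ _)
    | succ =>
      refine congrArg (Structure.funMap (L := LA) Func.succ) ?_
      funext i
      fin_cases i
      rfl
    | add =>
      refine Eq.trans (congrArg (Structure.funMap (L := LA) Func.add) ?_) (addM_numM _ _)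
      funext i
      fin_cases i <;> rfl
    | mul =>
      refine Eq.trans (congrArg (Structure.funMap (L := LA) Func.mul) ?_) (mulM_numM _ _)
      funext i
      fin_cases i <;> rfl

/-- At standard arguments the bound of each quantifier is a numeral, so by `ltM_numM_iff` the
quantifier ranges over the same numbers in `M` and in ℕ. -/
theorem IsDelta0.realize_numM {n : ℕ} {θ : LA.BoundedFormula Empty n} (h : IsDelta0 θ)
    (xs : Fin n → ℕ) : θ.Realize (default : Empty → M) (fun i => numM M (xs i)) ↔
      θ.Realize (noVars ℕ) xs := by
  have key : ∀ {n : ℕ} (xs : Fin n → ℕ) (t : LA.Term (Empty ⊕ Fin n)),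
      t.realize (Sum.elim (default : Empty → M) (fun i => numM M (xs i))) =
      numM M (t.realize (Sum.elim (noVars ℕ) xs)) := by
    intro n xs t
    rw [← realize_term_numM]
    congr 1
    funext a
    rcases a with a | a
    · exact a.elim
    · rfl
  have snoc_numM : ∀ {n : ℕ} (xs : Fin n → ℕ) (a : ℕ),
      (Fin.snoc (fun i => numM M (xs i)) (numM M a) : Fin (n + 1) → M) =
      fun i => numM M ((Fin.snoc xs a : Fin (n + 1) → ℕ) i) := by
    intro n xs a
    funext i
    induction i using Fin.lastCases <;> simp
  induction h with
  | falsum => exact Iff.rfl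
  | eq t u => simp only [realize_eq, key, numM_injective.eq_iff]
  | lt t u => simp only [realize_lt, key, numM_ltM_numM, ltM_nat]
  | imp _ _ ih₁ ih₂ => simp only [BoundedFormula.realize_imp, ih₁, ih₂]
  | ball t _ ih =>
    simp only [BoundedFormula.realize_all, BoundedFormula.realize_imp, realize_lt, realize_x,
      Fin.snoc_last, realize_up, key, ltM_numM_iff]
    constructor
    · intro h a ha
      refine (ih _).1 ?_
      rw [← snoc_numM]
      exact h _ ⟨a, by simpa using ha, rfl⟩
    · rintro h _ ⟨a, ha, rfl⟩
      rw [snoc_numM]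
      refine (ih _).2 ?_
      exact h a ha
  | bex t _ ih =>
    simp only [BoundedFormula.realize_ex, BoundedFormula.realize_inf, realize_lt, realize_x,
      Fin.snoc_last, realize_up, key, ltM_numM_iff]
    constructor
    · rintro ⟨_, ⟨a, ha, rfl⟩, h⟩
      rw [snoc_numM] at h
      exact ⟨a, ha, (ih _).1 h⟩
    · rintro ⟨a, ha, h⟩
      refine ⟨_, ⟨a, by simpa using ha, rfl⟩, ?_⟩
      rw [snoc_numM]
      exact (ih _).2 h

end Absoluteness

/-! ### Closure of Δ₀ and normal forms for Σ₁ and Π₁. -/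

theorem IsDelta0.not {n : ℕ} {φ : LA.BoundedFormula Empty n} (h : IsDelta0 φ) : IsDelta0 φ.not :=
  .imp h .falsum

theorem IsDelta0.inf {n : ℕ} {φ ψ : LA.BoundedFormula Empty n} (h₁ : IsDelta0 φ)
    (h₂ : IsDelta0 ψ) : IsDelta0 (φ ⊓ ψ) :=
  .not (.imp h₁ (.not h₂))

theorem sub_lt {n m : ℕ} (t u : LA.Term (Empty ⊕ Fin n))
    (σ : Empty ⊕ Fin n → LA.Term (Empty ⊕ Fin m)) :
    sub (lt t u) σ = lt (t.subst σ) (u.subst σ) :=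
  congrArg (BoundedFormula.rel (L := LA) Rel.lt) (comp_vec₂ (fun t => t.subst σ) t u)

theorem x_last_subst_liftSub {n m : ℕ} (σ : Empty ⊕ Fin n → LA.Term (Empty ⊕ Fin m)) :
    (x (Fin.last n)).subst (liftSub σ) = x (Fin.last m) := by
  simp [x, Term.subst, liftSub]

theorem IsDelta0.sub {n m : ℕ} {φ : LA.BoundedFormula Empty n} (h : IsDelta0 φ)
    (σ : Empty ⊕ Fin n → LA.Term (Empty ⊕ Fin m)) : IsDelta0 (FOProof.sub φ σ) := by
  induction h generalizing m with
  | falsum => exact .falsum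
  | eq t u => exact .eq _ _
  | lt t u =>
    rw [sub_lt]
    exact .lt _ _
  | imp _ _ ih₁ ih₂ => exact .imp (ih₁ σ) (ih₂ σ)
  | @ball n t φ _ ih =>
    have h := IsDelta0.ball (t.subst σ) (ih (liftSub σ))
    rwa [← x_last_subst_liftSub σ, ← up_subst_liftSub, ← sub_lt] at h
  | @bex n t φ _ ih =>
    have h := IsDelta0.bex (t.subst σ) (ih (liftSub σ))
    rwa [← x_last_subst_liftSub σ, ← up_subst_liftSub, ← sub_lt] at h

theorem IsDelta0.app {k n : ℕ} {φ : LA.BoundedFormula Empty k} (h : IsDelta0 φ)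
    (t : Fin k → LA.Term (Empty ⊕ Fin n)) : IsDelta0 (Arith.app φ t) := h.sub _

/-- The unbounded existential quantifiers of a `Σ₁` formula can be replaced by one bound. -/
theorem IsSigma1.exists_bound {n : ℕ} {φ : LA.BoundedFormula Empty n} (h : IsSigma1 φ) :
    ∃ θ : LA.BoundedFormula Empty (n + 1), IsDelta0 θ ∧
      ∀ (M : Type) [LA.Structure M] [IsModelPA M] (xs : Fin n → M),
        (φ.Realize default xs ↔ ∃ b, θ.Realize default (Fin.snoc xs b : Fin (n + 1) → M)) ∧
        ∀ b b', ltM b b' → θ.Realize default (Fin.snoc xs b : Fin (n + 1) → M) →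
          θ.Realize default (Fin.snoc xs b' : Fin (n + 1) → M) := by
  induction h with
  | @delta0 n φ h =>
    refine ⟨Arith.app φ fun i => x i.castSucc, h.app _, fun M _ _ xs => ?_⟩
    simp only [realize_app, realize_x, Fin.snoc_castSucc]
    exact ⟨⟨fun h => ⟨zeroM M, h⟩, fun ⟨_, h⟩ => h⟩, fun _ _ _ h => h⟩
  | @ex n φ _ ih =>
    obtain ⟨θ, hθ, h⟩ := ih
    -- The new matrix is ∃ z < b, θ(xs, z, b): a single `b` bounds the new witness and all the
    -- earlier ones.
    refine ⟨(lt (x (Fin.last (n + 1))) (up (x (Fin.last n))) ⊓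
      Arith.app θ (Fin.snoc (α := fun _ => LA.Term (Empty ⊕ Fin (n + 2)))
        (Fin.snoc (α := fun _ => LA.Term (Empty ⊕ Fin (n + 2)))
          (fun i => x i.castSucc.castSucc) (x (Fin.last (n + 1))))
        (x (Fin.last n).castSucc))).ex, .bex _ (hθ.app _), fun M _ _ xs => ?_⟩
    have hs : ∀ b c : M, (fun i => ((Fin.snoc (α := fun _ => LA.Term (Empty ⊕ Fin (n + 2)))
        (Fin.snoc (α := fun _ => LA.Term (Empty ⊕ Fin (n + 2)))
          (fun i => x i.castSucc.castSucc) (x (Fin.last (n + 1))))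
        (x (Fin.last n).castSucc)) i).realize
        (Sum.elim (default : Empty → M) (Fin.snoc (Fin.snoc xs b) c))) =
        (Fin.snoc (Fin.snoc xs c : Fin (n + 1) → M) b : Fin (n + 2) → M) := by
      intro b c
      funext i
      induction i using Fin.lastCases with
      | last => simp
      | cast i => induction i using Fin.lastCases <;> simp
    simp only [BoundedFormula.realize_ex, BoundedFormula.realize_inf, realize_lt, realize_x,
      Fin.snoc_last, realize_up, realize_app, hs, (h M _).1]
    refine ⟨⟨?_, ?_⟩, ?_⟩
    · rintro ⟨z, b, hb⟩
      -- A common strict bound is `b` or the successor of `z`; monotonicity of `θ` raises `b` to the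
      -- latter.
      rcases ltM_trichotomy z b with hz | rfl | hz
      · exact ⟨b, z, hz, hb⟩
      · have hlt : ltM z (succM z) := ltM_succM.2 (Or.inr rfl)
        exact ⟨succM z, z, hlt, (h M _).2 _ _ hlt hb⟩
      · have hlt : ltM z (succM z) := ltM_succM.2 (Or.inr rfl)
        exact ⟨succM z, z, hlt, (h M _).2 _ _ (ltM_trans hz hlt) hb⟩
    · rintro ⟨b, z, _, hb⟩
      exact ⟨z, b, hb⟩
    · rintro b b' hbb' ⟨z, hz, hb⟩
      exact ⟨z, ltM_trans hz hbb', (h M _).2 _ _ hbb' hb⟩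

/-- `IsSigma1` is a syntactic class, so the universal prefix is rewritten as an existential one and
only the matrix is negated. -/
theorem IsPi1.exists_sigma1_not {n : ℕ} {φ : LA.BoundedFormula Empty n} (h : IsPi1 φ) :
    ∃ ψ : LA.BoundedFormula Empty n, IsSigma1 ψ ∧
      ∀ (M : Type) [LA.Structure M] (xs : Fin n → M),
        ψ.Realize default xs ↔ ¬ φ.Realize default xs := by
  induction h with
  | @delta0 n φ h => exact ⟨φ.not, .delta0 h.not, fun M _ xs => BoundedFormula.realize_not⟩
  | all _ ih =>
    obtain ⟨ψ, hψ, h⟩ := ih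
    refine ⟨ψ.ex, .ex hψ, fun M _ xs => ?_⟩
    simp only [BoundedFormula.realize_ex, BoundedFormula.realize_all, h, not_forall]

end Arith

namespace Arith

open FOProof

/-! ### The interpreter that searches for a counterexample -/

section Vectors
variable {M : Type}

theorem snoc_vec₀ (xs : Fin 0 → M) (a : M) : (Fin.snoc xs a : Fin (0 + 1) → M) = ![a] := by
  funext i
  fin_cases i
  simp [Fin.snoc]

theorem snoc_vec₁ (a b : M) : (Fin.snoc ![a] b : Fin (1 + 1) → M) = ![a, b] := by
  funext i
  fin_cases i <;> rfl

theorem snoc_vec₂ (a b c : M) : (Fin.snoc ![a, b] c : Fin (2 + 1) → M) = ![a, b, c] := by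
  funext i
  fin_cases i <;> rfl

theorem snoc_vec₃ (a b c d : M) :
    (Fin.snoc ![a, b, c] d : Fin (3 + 1) → M) = ![a, b, c, d] := by
  funext i
  fin_cases i <;> rfl

theorem snoc_vec₄ (a b c d e : M) :
    (Fin.snoc ![a, b, c, d] e : Fin (4 + 1) → M) = ![a, b, c, d, e] := by
  funext i
  fin_cases i <;> rfl

end Vectors

/-- The term `(p + 1) · (p + 1)`, with `p` the outermost variable. -/
def boundTerm (n : ℕ) : LA.Term (Empty ⊕ Fin (n + 1)) := mul (succ (x 0)) (succ (x 0))

/-- The interpreter which, on input `p`, waits for the least `b` with `F(b)` and then outputs the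
least `y` with `¬ G(q, y, b)` for all `q < (p + 1) · (p + 1)`. -/
def searchInterpreter (F : LA.BoundedFormula Empty 1) (G : LA.BoundedFormula Empty 3) :
    LA.BoundedFormula Empty 2 :=
  (app F ![x (2 : Fin 3)] ⊓
    (((lt (x (Fin.last 3)) (up (x 2))).imp (app F ![x (3 : Fin 4)]).not).all ⊓
      -- Squaring doubles the length: for `p + 1 = 2 ^ (c + 1)` all programs of length at most 2c+1
      -- = |p| + c are excluded.
      (((lt (x (Fin.last 3)) (up (boundTerm 2))).imp
          (app G ![x (3 : Fin 4), x 1, x 2]).not).all ⊓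
        ((lt (x (Fin.last 3)) (up (x 1))).imp
          (lt (x (Fin.last 4)) (up (boundTerm 3)) ⊓
            app G ![x (4 : Fin 5), x 3, x 2]).ex).all))).ex

theorem isSigma1_searchInterpreter {F : LA.BoundedFormula Empty 1}
    {G : LA.BoundedFormula Empty 3} (hF : IsDelta0 F) (hG : IsDelta0 G) :
    IsSigma1 (searchInterpreter F G) :=
  .ex (.delta0 (.inf (hF.app _) (.inf (.ball _ (.not (hF.app _)))
    (.inf (.ball _ (.not (hG.app _))) (.ball _ (.bex _ (hG.app _)))))))

theorem realize_searchInterpreter {M : Type} [LA.Structure M] (F : LA.BoundedFormula Empty 1)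
    (G : LA.BoundedFormula Empty 3) (p y : M) :
    (searchInterpreter F G).Realize default ![p, y] ↔
      ∃ b, F.Realize default ![b] ∧ (∀ c, ltM c b → ¬ F.Realize default ![c]) ∧
        (∀ q, ltM q (mulM (succM p) (succM p)) → ¬ G.Realize default ![q, y, b]) ∧
        ∀ z, ltM z y → ∃ q, ltM q (mulM (succM p) (succM p)) ∧ G.Realize default ![q, z, b] := by
  have h₁ : ∀ {n : ℕ} (xs : Fin n → M) (t : LA.Term (Empty ⊕ Fin n)),
      (fun i => ((![t] : Fin 1 → LA.Term (Empty ⊕ Fin n)) i).realize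
        (Sum.elim (default : Empty → M) xs)) = ![t.realize (Sum.elim default xs)] :=
    fun xs t => comp_vec₁ (fun t => Term.realize (Sum.elim default xs) t) t
  have h₃ : ∀ {n : ℕ} (xs : Fin n → M) (t u w : LA.Term (Empty ⊕ Fin n)),
      (fun i => ((![t, u, w] : Fin 3 → LA.Term (Empty ⊕ Fin n)) i).realize
        (Sum.elim (default : Empty → M) xs)) =
      ![t.realize (Sum.elim default xs), u.realize (Sum.elim default xs),
        w.realize (Sum.elim default xs)] :=
    fun xs t u w => comp_vec₃ (fun t => Term.realize (Sum.elim default xs) t) t u w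
  simp only [searchInterpreter, BoundedFormula.realize_ex, BoundedFormula.realize_inf,
    BoundedFormula.realize_all, BoundedFormula.realize_imp, BoundedFormula.realize_not, realize_lt,
    realize_up, realize_app, h₁, h₃, realize_x, Fin.snoc_last, boundTerm, realize_mul,
    realize_succ]
  simp only [snoc_vec₂, snoc_vec₃, snoc_vec₄]
  rfl

/-- Both `b` and `y` are least elements, so trichotomy settles uniqueness. -/
theorem searchInterpreter_functional {M : Type} [LA.Structure M] [IsModelPA M]
    {F : LA.BoundedFormula Empty 1} {G : LA.BoundedFormula Empty 3} {p y y' : M}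
    (h : (searchInterpreter F G).Realize default ![p, y])
    (h' : (searchInterpreter F G).Realize default ![p, y']) : y = y' := by
  rw [realize_searchInterpreter] at h h'
  obtain ⟨b, h₁, h₂, h₃, h₄⟩ := h
  obtain ⟨b', h₁', h₂', h₃', h₄'⟩ := h'
  have hb : b = b' := by
    rcases ltM_trichotomy b b' with hlt | heq | hlt
    exacts [(h₂' b hlt h₁).elim, heq, (h₂ b' hlt h₁').elim]
  subst hb
  rcases ltM_trichotomy y y' with hlt | heq | hlt
  · obtain ⟨q, hq, hG⟩ := h₄' y hlt
    exact (h₃ q hq hG).elim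
  · exact heq
  · obtain ⟨q, hq, hG⟩ := h₄ y' hlt
    exact (h₃' q hq hG).elim

/-! ### The sentences about interpreters, read in a model. -/

section Realize
variable {M : Type} [LA.Structure M]

theorem realize_functional (D : LA.BoundedFormula Empty 2) :
    Sentence.Realize M (((app D ![x (0 : Fin 3), x 1]).imp
      ((app D ![x (0 : Fin 3), x 2]).imp (eq (x 1) (x 2)))).all.all.all) ↔
    ∀ p y y' : M, D.Realize default ![p, y] → D.Realize default ![p, y'] → y = y' := by
  have h₂ : ∀ (xs : Fin 3 → M) (i j : Fin 3),
      (fun k => ((![x i, x j] : Fin 2 → LA.Term (Empty ⊕ Fin 3)) k).realize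
        (Sum.elim (default : Empty → M) xs)) = ![xs i, xs j] :=
    fun xs i j => comp_vec₂ (fun t => Term.realize _ t) (x i) (x j)
  simp only [Sentence.Realize, Formula.Realize, BoundedFormula.realize_all,
    BoundedFormula.realize_imp, realize_app, realize_eq, realize_x, h₂, snoc_vec₀, snoc_vec₁,
    snoc_vec₂]
  rfl

/-- The power-of-two clause is dropped: the lemma is applied where `u + 1` is itself a power of two,
and there the bound on `w` is enough. -/
theorem realize_lenLe {n : ℕ} (xs : Fin n → M) (t u : LA.Term (Empty ⊕ Fin n)) (c : ℕ)
    (h : (lenLe t u c).Realize (default : Empty → M) xs) :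
    ∃ w : M, ltM w (succM (succM (u.realize (Sum.elim default xs)))) ∧
      ltM (succM (t.realize (Sum.elim default xs))) (mulM (numM M (2 ^ (c + 1))) w) := by
  simp only [lenLe, BoundedFormula.realize_ex, BoundedFormula.realize_inf, realize_lt, realize_x,
    realize_succ, realize_mul, realize_num, realize_up, Fin.snoc_last] at h
  obtain ⟨w, -, h₁, h₂⟩ := h
  exact ⟨w, h₁, h₂⟩

theorem realize_complexityLe {D E : LA.BoundedFormula Empty 2} {c : ℕ}
    (h : Sentence.Realize M (complexityLe D E c)) {y q : M} (hE : E.Realize default ![q, y]) :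
    ∃ p w : M, D.Realize default ![p, y] ∧ ltM w (succM (succM q)) ∧
      ltM (succM p) (mulM (numM M (2 ^ (c + 1))) w) := by
  have h₂ : ∀ {n : ℕ} (xs : Fin n → M) (i j : Fin n),
      (fun k => ((![x i, x j] : Fin 2 → LA.Term (Empty ⊕ Fin n)) k).realize
        (Sum.elim (default : Empty → M) xs)) = ![xs i, xs j] :=
    fun xs i j => comp_vec₂ (fun t => Term.realize _ t) (x i) (x j)
  simp only [complexityLe, Sentence.Realize, Formula.Realize, BoundedFormula.realize_all,
    BoundedFormula.realize_imp, BoundedFormula.realize_ex, BoundedFormula.realize_inf, realize_app,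
    h₂, snoc_vec₀, snoc_vec₁, snoc_vec₂] at h
  obtain ⟨p, hp, hD⟩ := h y q hE
  obtain ⟨w, hw⟩ := realize_lenLe _ _ _ _ hp
  exact ⟨p, w, hD, hw⟩

theorem realize_complexityGt (D : LA.BoundedFormula Empty 2) (s : List Bool) (n : ℕ) :
    Sentence.Realize M (complexityGt D s n) ↔
      ∀ q : M, ltM (succM q) (numM M (2 ^ (n + 1))) →
        ¬ D.Realize default ![q, numM M (code s)] := by
  have h₂ : ∀ (xs : Fin 1 → M), (fun k => ((![x 0, num (code s)] :
      Fin 2 → LA.Term (Empty ⊕ Fin 1)) k).realize (Sum.elim (default : Empty → M) xs)) =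
      ![xs 0, numM M (code s)] :=
    fun xs => (comp_vec₂ (fun t => Term.realize _ t) (x 0) (num (code s))).trans (by simp)
  simp only [complexityGt, Sentence.Realize, Formula.Realize, BoundedFormula.realize_all,
    BoundedFormula.realize_imp, BoundedFormula.realize_not, realize_app, h₂, realize_lt, realize_x,
    realize_succ, realize_num, snoc_vec₀]
  rfl

end Realize

/-! ### The contradiction in a model with a counterexample. -/

theorem code_surjective : Function.Surjective code := by
  intro k
  induction k using Nat.strong_induction_on with
  | _ k ih =>
    rcases Nat.eq_zero_or_pos k with rfl | hk
    · exact ⟨[], rfl⟩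
    · obtain ⟨s, hs⟩ := ih ((k - 1) / 2) (by omega)
      rcases Nat.mod_two_eq_zero_or_one k with h | h
      · exact ⟨true :: s, by simp [code, hs]; omega⟩
      · exact ⟨false :: s, by simp [code, hs]; omega⟩

/-- Some number is not the output of any of the programs `q < N`. -/
theorem exists_forall_not_output {D : LA.BoundedFormula Empty 2} (hD : IsInterpreter D) (N : ℕ) :
    ∃ y : ℕ, ∀ q < N, ¬ D.Realize (noVars ℕ) ![q, y] := by
  -- Functionality of `D` is provable in PA, hence true in ℕ, so finitely many programs have
  -- finitely many outputs.
  have hfun := (realize_functional D).1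
    (hD.2.sound (M := ℕ) fun _ h => IsModelPA.realize _ h)
  have hfin : (⋃ q ∈ Set.Iio N, {y : ℕ | D.Realize (noVars ℕ) ![q, y]}).Finite :=
    (Set.finite_Iio N).biUnion fun q _ =>
      Set.Subsingleton.finite fun y hy y' hy' => by
        simp only [Set.mem_ofPred_eq] at hy hy'
        exact hfun q y y' hy hy'
  obtain ⟨y, hy⟩ := hfin.exists_notMem
  exact ⟨y, fun q hq h => hy (Set.mem_biUnion (show q ∈ Set.Iio N from hq) h)⟩

/-- In a model of arithmetic satisfying all true lower bounds for complexity, there is no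
counterexample to a true `Π₁` sentence. -/
theorem false_of_counterexample {M : Type} [LA.Structure M] [IsModelPA M]
    {D : LA.BoundedFormula Empty 2} (hD : IsInterpreter D) {F : LA.BoundedFormula Empty 1}
    {G : LA.BoundedFormula Empty 3} (hF : IsDelta0 F) (hG : IsDelta0 G)
    (hGD : ∀ (N : Type) [LA.Structure N] [IsModelPA N] (xs : Fin 2 → N),
      (D.Realize default xs ↔ ∃ b, G.Realize default (Fin.snoc xs b : Fin 3 → N)) ∧
      ∀ b b', ltM b b' → G.Realize default (Fin.snoc xs b : Fin 3 → N) →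
        G.Realize default (Fin.snoc xs b' : Fin 3 → N))
    {c : ℕ} (hc : Sentence.Realize M (complexityLe D (searchInterpreter F G) c))
    (hax : ∀ φ ∈ trueComplexityAxioms D, Sentence.Realize M φ)
    (hFnat : ∀ k : ℕ, ¬ F.Realize (noVars ℕ) ![k]) {b : M} (hb : F.Realize default ![b]) : False := by
  have hpow : ∀ k : ℕ, 2 ^ k * 2 ^ k = 2 ^ (2 * k) := fun k => by rw [← pow_add, two_mul]
  have numM₁ : ∀ k : ℕ, (fun i => numM M (![k] i)) = ![numM M k] := fun k => comp_vec₁ _ _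
  have numM₃ : ∀ i j k : ℕ, (fun l => numM M (![i, j, k] l)) = ![numM M i, numM M j, numM M k] :=
    fun i j k => comp_vec₃ _ _ _ _
  -- Every number codes a string, so each lower bound true in ℕ is an axiom and transfers to `M`.
  have hax' : ∀ y n : ℕ, (∀ q, q + 1 < 2 ^ (n + 1) → ¬ D.Realize (noVars ℕ) ![q, y]) →
      ∀ q : M, ltM (succM q) (numM M (2 ^ (n + 1))) → ¬ D.Realize default ![q, numM M y] := by
    intro y n h
    obtain ⟨s, rfl⟩ := code_surjective y
    refine (realize_complexityGt D s n).1 (hax _ ⟨⟨s, n, rfl⟩, ?_⟩)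
    rw [realize_complexityGt]
    simpa only [numM_nat, ltM_nat, succM_nat] using h
  obtain ⟨b, hb, hbmin⟩ : ∃ b : M, F.Realize default ![b] ∧
      ∀ a, ltM a b → ¬ F.Realize default ![a] := by
    have := exists_least F ![] (a := b) (by rwa [snoc_vec₀])
    simpa only [snoc_vec₀] using this
  have hbig : ∀ k, ltM (numM M k) b := by
    refine numM_ltM_of_nonstandard fun k hk => hFnat k ?_
    rw [← hF.realize_numM M, numM₁, ← hk]
    exact hb
  obtain ⟨p, hp⟩ : ∃ p, p + 1 = 2 ^ (c + 1) := 
    ⟨2 ^ (c + 1) - 1, Nat.sub_add_cancel Nat.one_le_two_pow⟩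
  have hbound : mulM (succM (numM M p)) (succM (numM M p)) =
      numM M (2 ^ (c + 1) * 2 ^ (c + 1)) := by
    rw [← hp, ← mulM_numM]
    rfl
  -- `P` concerns standard `y` only, so its minimum is taken in ℕ. Only numerals lie below a
  -- numeral, so this is the least candidate in `M` as well.
  let P : ℕ → Prop := fun y =>
    ∀ j < 2 ^ (c + 1) * 2 ^ (c + 1), ¬ G.Realize default ![numM M j, numM M y, b]
  have hP : ∃ y, P y := by
    -- The last program searched, `2 ^ (2 * c + 2) - 1`, has length 2c+2, so the bound C(y) > 2c+1
    -- would not suffice here.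
    obtain ⟨y, hy⟩ := exists_forall_not_output hD (2 ^ (2 * c + 2 + 1))
    refine ⟨y, fun j hj hG => hax' y (2 * c + 2) (fun q hq => hy q (by omega)) (numM M j) ?_ ?_⟩
    · refine numM_ltM_numM.2 (lt_of_le_of_lt hj ?_)
      rw [hpow]
      exact Nat.pow_lt_pow_right one_lt_two (by omega)
    · rw [(hGD M _).1]
      exact ⟨b, by rwa [snoc_vec₂]⟩
  classical
  set y := Nat.find hP with hy
  have hPy : P y := Nat.find_spec hP
  have hE : (searchInterpreter F G).Realize default ![numM M p, numM M y] := by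
    refine (realize_searchInterpreter _ _ _ _).2 ⟨b, hb, hbmin, fun q hq => ?_, fun z hz => ?_⟩
    · rw [hbound] at hq
      obtain ⟨j, hj, rfl⟩ := ltM_numM_iff.1 hq
      exact hPy j hj
    · obtain ⟨i, hi, rfl⟩ := ltM_numM_iff.1 hz
      have := Nat.find_min hP hi
      simp only [P, not_forall, not_not] at this
      obtain ⟨j, hj, hG⟩ := this
      exact ⟨numM M j, by rw [hbound]; exact numM_ltM_numM.2 hj, hG⟩
  obtain ⟨q, w, hDq, hw, hq⟩ := realize_complexityLe hc hE
  obtain ⟨i, hi, rfl⟩ := (ltM_numM_iff (k := p + 2)).1 hw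
  -- C(y) > 2c+1 holds in ℕ: a standard halting time `b₀` lies below `b`, so monotonicity of `G`
  -- would contradict `P y`. The program `q` violates this bound in `M`, because `q + 1 < 2 ^ (c +
  -- 1) * i` with `i ≤ 2 ^ (c + 1)`.
  refine hax' y (2 * c + 1) (fun j hj hDj => ?_) q ?_ hDq
  · obtain ⟨b₀, hb₀⟩ := (hGD ℕ _).1.1 hDj
    rw [snoc_vec₂, ← hG.realize_numM M, numM₃] at hb₀
    refine hPy j ?_ ?_
    · rw [hpow]
      exact j.lt_succ_self.trans hj
    · have := (hGD M ![numM M j, numM M y]).2 (numM M b₀) b (hbig b₀)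
      rw [snoc_vec₂, snoc_vec₂] at this
      exact this hb₀
  · rw [mulM_numM] at hq
    obtain ⟨l, hl, hql⟩ := ltM_numM_iff.1 hq
    rw [hql]
    refine numM_ltM_numM.2 (hl.trans_le ?_)
    refine (Nat.mul_le_mul_left _ (show i ≤ 2 ^ (c + 1) by omega)).trans_eq ?_
    rw [hpow]
    rfl

end Arith

theorem theorem4 (D : Arith.LA.BoundedFormula Empty 2) (hD : Arith.ProvablyOptimal D)
    (φ : Arith.LA.Sentence) (hφ : Arith.IsPi1 φ) (htrue : Sentence.Realize ℕ φ) :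
    FOProof.Proves (Arith.PA ∪ Arith.trueComplexityAxioms D) φ := by
  obtain ⟨ψ, hψ, hψφ⟩ := hφ.exists_sigma1_not
  obtain ⟨F, hF, hFψ⟩ := hψ.exists_bound
  obtain ⟨G, hG, hGD⟩ := hD.1.1.exists_bound
  -- Optimality applies only to interpreters that are provably functional; completeness turns
  -- functionality in all models into a PA proof.
  have hE : Arith.IsInterpreter (Arith.searchInterpreter F G) := by
    refine ⟨Arith.isSigma1_searchInterpreter hF hG,
      FOProof.proves_of_forall_model fun M _ _ hM => ?_⟩
    have : Arith.IsModelPA M := ⟨hM⟩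
    exact (Arith.realize_functional _).2 fun _ _ _ => Arith.searchInterpreter_functional
  obtain ⟨c, hc⟩ := hD.2 _ hE
  refine FOProof.proves_of_forall_model fun M _ _ hM => ?_
  have : Arith.IsModelPA M := ⟨fun ψ h => hM ψ (Or.inl h)⟩
  by_contra hnot
  obtain ⟨b, hb⟩ := (hFψ M default).1.1 ((hψφ M default).2 hnot)
  rw [Arith.snoc_vec₀] at hb
  refine Arith.false_of_counterexample hD.1 hF hG hGD (hc.sound Arith.IsModelPA.realize)
    (fun ψ h => hM ψ (Or.inr h)) (fun k hk => ?_) hb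
  rw [← Arith.snoc_vec₀ default] at hk
  refine (hψφ ℕ default).1 ((hFψ ℕ default).1.2 ⟨k, hk⟩) ?_
  rwa [Subsingleton.elim (default : Fin 0 → ℕ)]
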